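/- A polytope is a nonempty bounded intersection of finitely many closed half-spaces of $E^n=\mathbb R^n$. A finite polyhedral complex is a finite set of polytopes (its faces), closed under passing to nonempty faces, any two of which are disjoint or meet in a common face; a compact PL-space $X$ is the union of the faces of such a complex, and we speak of the faces of $X$. If $X_1,X_2$ are compact PL-spaces (with given complexes), then $X_1\cap X_2$ carries the complex whose faces are the nonempty intersections of a face of $X_1$ with a face of $X_2$. For $X\subset E^n$, $a\in E^n$ and $r,\delta>0$ put $$C(X,0,a)=\{y\in X: |y|\le r,\ -\delta\le\langle y,a\rangle\le\delta\},\qquad L(X,0,a)=\{y\in X: |y|\le r,\ \langle y,a\rangle=\delta\}.$$ The product of pairs is $(C/L)\times(C'/L')=(C\times C'\,/\,L\times C'\cup C\times L')$, and $(C/L)\simeq(D/M)$ means that there is a homeomorphism $C\to D$ that maps $L$ onto $M$. **Proposition 2.5.** Let $X_1,X_2\subset E^n$ be compact PL-spaces, $F_1$ a face of $X_1$ of dimension $k$ and $F_2$ a face of $X_2$ of dimension $n-k$, whose relative interiors meet exactly in $\{0\}$. Let $E_i$ be the linear hull of $F_i$ (so $E^n=E_1\oplus E_2$). Let $a\in E^n$,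 $|a|=1$, be such that the hyperplane $\{y:\langle y,a\rangle=0\}$ contains no face $F$ of $X_1\cap X_2$ unless $F=\{0\}$. For $a_i\in E_i$ put $\bar a_i=|a_i|^{-1}a_i$ if $a_i\ne0$ and $\bar a_i=0$ if $a_i=0$, and put $j=2$ for $i=1$, $j=1$ for $i=2$. (a) Suppose $E_1\perp E_2$ and let $a=a_1+a_2$ with $a_i\in E_i$. Then $a_i\neq0$ whenever $0$ is not an isolated point of $X_j\cap E_i$. Moreover there are $r_0,\kappa>0$ such that $$(C/L)\simeq(C_1/L_1)\times(C_2/L_2),$$ where $C=C(X_1\cap X_2,0,a)$, $L=L(X_1\cap X_2,0,a)$, $C_i=C(X_j\cap E_i,0,\bar a_i)$, $L_i=L(X_j\cap E_i,0,\bar a_i)$, and where each of the three pairs is formed with parameters $r,\delta$ of its own, chosen arbitrarily with $0<r\le r_0$ and $0<\delta\le\kappa r$. (b) The conclusions of (a) remain true if $E_1$ and $E_2$ are not orthogonal, when $a_i$ denotes the orthogonal projection of $a$ to $E_i$ (equivalently, $\langle y,a\rangle=\langle y_1,a_1\rangle+\langle y_2,a_2\rangle$ for $y=y_1+y_2$,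 $y_i\in E_i$). -/

import Mathlib

open scoped RealInnerProductSpace

section Polyhedra

variable {E : Type*} [NormedAddCommGroup E] [InnerProductSpace ℝ E]

/-- A (convex) polytope: a bounded intersection of finitely many closed half-spaces. -/
def IsPolytope (P : Set E) : Prop :=
  Bornology.IsBounded P ∧
    ∃ H : Finset (E × ℝ), P = {y | ∀ h ∈ H, ⟪h.1, y⟫ ≤ h.2}

/-- `F` is a (nonempty) face of the convex set `P`: a nonempty convex subset such that every
segment in `P` with a relative interior point in `F` has its end points in `F`. -/
def IsFaceOf (P F : Set E) : Prop :=
  F.Nonempty ∧ Convex ℝ F ∧ IsExtreme ℝ P F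

variable (E) in
/-- A finite polyhedral complex in `E`: finitely many nonempty polytopes, called the faces of the
complex, closed under passing to faces, any two of which are disjoint or meet in a common face.
(Finite geometric simplicial complexes are the case where all faces are simplices.) -/
structure PolyhedralComplex where
  faces : Set (Set E)
  finite : faces.Finite
  nonempty : ∀ P ∈ faces, P.Nonempty
  polytope : ∀ P ∈ faces, IsPolytope P
  face_mem : ∀ P ∈ faces, ∀ F, IsFaceOf P F → F ∈ faces
  inter_face : ∀ P ∈ faces, ∀ Q ∈ faces, (P ∩ Q).Nonempty → IsFaceOf P (P ∩ Q)

/-- The compact PL-space underlying a finite polyhedral complex. -/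
def PolyhedralComplex.space (K : PolyhedralComplex E) : Set E := ⋃₀ K.faces

theorem IsPolytope.convex {P : Set E} (hP : IsPolytope P) : Convex ℝ P := by
  obtain ⟨-, H, rfl⟩ := hP
  intro x hx y hy s t hs ht hst h hh
  have h1 := hx h hh
  have h2 := hy h hh
  rw [inner_add_right, real_inner_smul_right, real_inner_smul_right]
  calc s * ⟪h.1, x⟫ + t * ⟪h.1, y⟫ ≤ s * h.2 + t * h.2 := by gcongr
    _ = h.2 := by rw [← add_mul, hst, one_mul]

theorem IsPolytope.inter {P Q : Set E} (hP : IsPolytope P) (hQ : IsPolytope Q) :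
    IsPolytope (P ∩ Q) := by
  classical
  obtain ⟨bP, H, hH⟩ := hP
  obtain ⟨-, H', hH'⟩ := hQ
  refine ⟨bP.subset Set.inter_subset_left, H ∪ H', ?_⟩
  ext y
  simp only [hH, hH', Set.mem_inter_iff, Set.mem_ofPred_eq, Finset.mem_union]
  exact ⟨fun ⟨h1, h2⟩ h hh => hh.elim (h1 h) (h2 h),
    fun h => ⟨fun g hg => h g (Or.inl hg), fun g hg => h g (Or.inr hg)⟩⟩

/-- The smallest face of the convex set `P` that contains the point `x`. -/
def minFace (P : Set E) (x : E) : Set E :=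
  {y | y ∈ P ∧ ∃ ε : ℝ, 0 < ε ∧ x + ε • (x - y) ∈ P}

theorem shrink_mem {P : Set E} (hP : Convex ℝ P) {x y : E} (hx : x ∈ P) {ε ε' : ℝ}
    (h0 : 0 ≤ ε') (hle : ε' ≤ ε) (h : x + ε • (x - y) ∈ P) : x + ε' • (x - y) ∈ P := by
  rcases h0.eq_or_lt with rfl | hpos
  · simpa using hx
  · have hε : 0 < ε := hpos.trans_le hle
    have hd : ε' / ε ≤ 1 := (div_le_one hε).2 hle
    have h1 := hP hx h (sub_nonneg.2 hd) (div_nonneg h0 hε.le) (by ring)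
    convert h1 using 1
    rw [smul_add, smul_smul, div_mul_cancel₀ _ hε.ne', ← add_assoc, ← add_smul]
    simp

theorem isFaceOf_minFace {P : Set E} (hP : Convex ℝ P) {x : E} (hx : x ∈ P) :
    IsFaceOf P (minFace P x) := by
  refine ⟨⟨x, hx, 1, one_pos, by simpa using hx⟩, ?_, ?_, ?_⟩
  · rintro y ⟨hy, ε, hε, hyε⟩ z ⟨hz, η, hη, hzη⟩ s t hs ht hst
    refine ⟨hP hy hz hs ht hst, min ε η, lt_min hε hη, ?_⟩
    have h1 := shrink_mem hP hx (lt_min hε hη).le (min_le_left ε η) hyε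
    have h2 := shrink_mem hP hx (lt_min hε hη).le (min_le_right ε η) hzη
    have h3 := hP h1 h2 hs ht hst
    convert h3 using 1
    obtain rfl : t = 1 - s := by linarith
    module
  · exact fun y hy => hy.1
  · rintro y₁ hy₁ y₂ hy₂ y ⟨hy, ε, hε, hyε⟩ ⟨s, t, hs, ht, hst, rfl⟩
    have hpos : 0 < 1 + ε * t := by positivity
    refine ⟨hy₁, ε * s / (1 + ε * t), by positivity, ?_⟩
    have h := hP hyε hy₂ (a := 1 / (1 + ε * t)) (b := ε * t / (1 + ε * t))
      (by positivity) (by positivity) (by field_simp)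
    convert h using 1
    obtain rfl : t = 1 - s := by linarith
    match_scalars <;> field_simp <;> ring

theorem extend_mem {F : Set E} {x y : E} (hx : x ∈ intrinsicInterior ℝ F) (hy : y ∈ F) :
    ∃ ε : ℝ, 0 < ε ∧ x + ε • (x - y) ∈ F := by
  rw [mem_intrinsicInterior] at hx
  obtain ⟨x', hx', rfl⟩ := hx
  have hy' : y ∈ affineSpan ℝ F := subset_affineSpan ℝ F hy
  have hmem : ∀ t : ℝ, (x' : E) + t • ((x' : E) - y) ∈ affineSpan ℝ F := by
    intro t
    have := AffineSubspace.vadd_mem_of_mem_direction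
      ((affineSpan ℝ F).direction.smul_mem t
        (AffineSubspace.vsub_mem_direction x'.2 hy')) x'.2
    simpa [add_comm] using this
  let f : ℝ → affineSpan ℝ F := fun t => ⟨(x' : E) + t • ((x' : E) - y), hmem t⟩
  have hf : Continuous f := by
    apply Continuous.subtype_mk
    fun_prop
  have hf0 : f 0 = x' := by ext; simp [f]
  have hnhds : f ⁻¹' (interior ((↑) ⁻¹' F)) ∈ nhds (0 : ℝ) :=
    (isOpen_interior.preimage hf).mem_nhds (by simpa [hf0] using hx')
  obtain ⟨ε, hε, hb⟩ := Metric.mem_nhds_iff.1 hnhds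
  have h2 : f (ε / 2) ∈ interior ((↑) ⁻¹' F : Set (affineSpan ℝ F)) := by
    apply hb
    rw [Metric.mem_ball, Real.dist_eq, sub_zero, abs_of_pos (by positivity)]
    linarith
  have h3 : f (ε / 2) ∈ ((↑) ⁻¹' F : Set (affineSpan ℝ F)) := interior_subset h2
  exact ⟨ε / 2, by positivity, h3⟩

variable [FiniteDimensional ℝ E]

theorem face_inter {P Q F : Set E} (hP : Convex ℝ P) (hQ : Convex ℝ Q)
    (hF : IsFaceOf (P ∩ Q) F) :
    ∃ P' Q', IsFaceOf P P' ∧ IsFaceOf Q Q' ∧ F = P' ∩ Q' := by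
  obtain ⟨hne, hconv, hsub, hext⟩ := hF
  obtain ⟨x, hx⟩ := hne.intrinsicInterior hconv
  have hxF : x ∈ F := intrinsicInterior_subset hx
  have hxPQ := hsub hxF
  refine ⟨minFace P x, minFace Q x, isFaceOf_minFace hP hxPQ.1, isFaceOf_minFace hQ hxPQ.2, ?_⟩
  ext y
  constructor
  · intro hy
    obtain ⟨ε, hε, h⟩ := extend_mem hx hy
    exact ⟨⟨(hsub hy).1, ε, hε, (hsub h).1⟩, ⟨(hsub hy).2, ε, hε, (hsub h).2⟩⟩
  · rintro ⟨⟨hyP, ε, hε, h1⟩, ⟨hyQ, η, hη, h2⟩⟩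
    have hpos := lt_min hε hη
    have h1' := shrink_mem hP hxPQ.1 hpos.le (min_le_left ε η) h1
    have h2' := shrink_mem hQ hxPQ.2 hpos.le (min_le_right ε η) h2
    set θ := min ε η
    refine hext ⟨hyP, hyQ⟩ ⟨h1', h2'⟩ hxF ⟨θ / (1 + θ), 1 / (1 + θ), by positivity,
      by positivity, by field_simp; ring, ?_⟩
    match_scalars <;> field_simp <;> ring

/-- The intersection of two polyhedral complexes: its faces are the nonempty intersections of a
face of the one with a face of the other. -/
def PolyhedralComplex.inter (K₁ K₂ : PolyhedralComplex E) : PolyhedralComplex E where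
  faces := {F | F.Nonempty ∧ ∃ P ∈ K₁.faces, ∃ Q ∈ K₂.faces, F = P ∩ Q}
  finite := (Set.Finite.image2 (· ∩ ·) K₁.finite K₂.finite).subset (by
    rintro F ⟨-, P, hP, Q, hQ, rfl⟩
    exact ⟨P, hP, Q, hQ, rfl⟩)
  nonempty := fun _ h => h.1
  polytope := by
    rintro F ⟨-, P, hP, Q, hQ, rfl⟩
    exact (K₁.polytope P hP).inter (K₂.polytope Q hQ)
  face_mem := by
    rintro R ⟨-, P, hP, Q, hQ, rfl⟩ F hF
    obtain ⟨P', Q', hP', hQ', rfl⟩ :=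
      face_inter (K₁.polytope P hP).convex (K₂.polytope Q hQ).convex hF
    exact ⟨hF.1, P', K₁.face_mem P hP P' hP', Q', K₂.face_mem Q hQ Q' hQ', rfl⟩
  inter_face := by
    rintro R ⟨-, P, hP, Q, hQ, rfl⟩ R' ⟨-, P', hP', Q', hQ', rfl⟩ hne
    have e : P ∩ Q ∩ (P' ∩ Q') = (P ∩ P') ∩ (Q ∩ Q') := Set.inter_inter_inter_comm P Q P' Q'
    have h1 := K₁.inter_face P hP P' hP' (by rw [e] at hne; exact hne.mono Set.inter_subset_left)
    have h2 := K₂.inter_face Q hQ Q' hQ' (by rw [e] at hne; exact hne.mono Set.inter_subset_right)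
    refine ⟨hne, ?_, ?_, ?_⟩
    · rw [e]; exact h1.2.1.inter h2.2.1
    · exact Set.inter_subset_left
    · intro y₁ hy₁ y₂ hy₂ y hy hseg
      rw [e] at hy ⊢
      exact ⟨h1.2.2.2 hy₁.1 hy₂.1 hy.1 hseg, h2.2.2.2 hy₁.2 hy₂.2 hy.2 hseg⟩

theorem PolyhedralComplex.space_inter (K₁ K₂ : PolyhedralComplex E) :
    (K₁.inter K₂).space = K₁.space ∩ K₂.space := by
  ext y
  constructor
  · rintro ⟨F, ⟨-, P, hP, Q, hQ, rfl⟩, hy⟩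
    exact ⟨⟨P, hP, hy.1⟩, ⟨Q, hQ, hy.2⟩⟩
  · rintro ⟨⟨P, hP, hyP⟩, ⟨Q, hQ, hyQ⟩⟩
    exact ⟨P ∩ Q, ⟨⟨y, hyP, hyQ⟩, P, hP, Q, hQ, rfl⟩, hyP, hyQ⟩

end Polyhedra

section Pairs

/-- A pair of spaces `(space / sub)`, realized by subsets of an ambient type
(`sub` is meant to be contained in `space`). -/
structure SpacePair (α : Type*) where
  space : Set α
  sub : Set α

/-- The product of pairs `(C / L) × (C' / L') = (C × C' / L × C' ∪ C × L')`. -/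
def SpacePair.prod {α β : Type*} (P : SpacePair α) (Q : SpacePair β) : SpacePair (α × β) where
  space := P.space ×ˢ Q.space
  sub := P.sub ×ˢ Q.space ∪ P.space ×ˢ Q.sub

/-- Homeomorphy of pairs: a homeomorphism of the spaces that maps the one subspace onto the
other. -/
def SpacePair.IsHomeomorphic {α β : Type*} [TopologicalSpace α] [TopologicalSpace β]
    (P : SpacePair α) (Q : SpacePair β) : Prop :=
  ∃ h : P.space ≃ₜ Q.space, ∀ p : P.space, (p : α) ∈ P.sub ↔ (h p : β) ∈ Q.sub

variable {E : Type*} [NormedAddCommGroup E] [InnerProductSpace ℝ E]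

/-- The genericity condition `(∗)` at `x` for the direction `a`: the hyperplane
`{y | ⟪y - x, a⟫ = 0}` contains no face of the complex, except possibly the face `{x}`. -/
def PolyhedralComplex.IsGeneric (K : PolyhedralComplex E) (x a : E) : Prop :=
  ∀ F ∈ K.faces, F ⊆ {y | ⟪y - x, a⟫ = 0} → F = {x}

/-- The pair (cone / link) of `X` at `x` in direction `a`, formed with the parameters `r`, `δ`. -/
def coneLink (X : Set E) (x a : E) (r δ : ℝ) : SpacePair E where
  space := {y | y ∈ X ∩ Metric.closedBall x r ∧ -δ ≤ ⟪y - x, a⟫ ∧ ⟪y - x, a⟫ ≤ δ}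
  sub := {y | y ∈ X ∩ Metric.closedBall x r ∧ ⟪y - x, a⟫ = δ}

theorem coneLink_sub_subset (X : Set E) (x a : E) (r : ℝ) {δ : ℝ} (hδ : 0 < δ) :
    (coneLink X x a r δ).sub ⊆ (coneLink X x a r δ).space := by
  rintro y ⟨hy, h⟩
  exact ⟨hy, by linarith, h.le⟩

/-- The parameters of a cone / link pair are small with respect to the thresholds `r₀` and `κ`:
`0 < r ≤ r₀` and `0 < δ ≤ κ r`. -/
def SmallParams (r₀ κ r δ : ℝ) : Prop :=
  0 < r ∧ r ≤ r₀ ∧ 0 < δ ∧ δ ≤ κ * r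

/-- The conclusion for the components `a₁`, `a₂` of the direction `a`. First, `aᵢ` can vanish only
if `0` is an isolated point of the slice `Xⱼ ∩ Eᵢ`. Secondly, for all small parameters, the pair of
`X₁ ∩ X₂` in direction `a` is homeomorphic to the product of the pairs of the slices in the
normalised directions `‖aᵢ‖⁻¹ • aᵢ` (read as `0` if `aᵢ = 0`). -/
def ConeLinkProduct (X₁ X₂ : Set E) (E₁ E₂ : Submodule ℝ E) (a a₁ a₂ : E) : Prop :=
  (a₁ = 0 → ∃ ε > 0, X₂ ∩ E₁ ∩ Metric.ball 0 ε = {0}) ∧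
  (a₂ = 0 → ∃ ε > 0, X₁ ∩ E₂ ∩ Metric.ball 0 ε = {0}) ∧
  ∃ r₀ > 0, ∃ κ > 0, ∀ r δ r₁ δ₁ r₂ δ₂ : ℝ,
    SmallParams r₀ κ r δ → SmallParams r₀ κ r₁ δ₁ → SmallParams r₀ κ r₂ δ₂ →
    (coneLink (X₁ ∩ X₂) 0 a r δ).IsHomeomorphic
      ((coneLink (X₂ ∩ E₁) 0 (‖a₁‖⁻¹ • a₁) r₁ δ₁).prod
        (coneLink (X₁ ∩ E₂) 0 (‖a₂‖⁻¹ • a₂) r₂ δ₂))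

end Pairs

/-! Locally the problem is one about cones. Since `0` is a relative interior point of `F₁`, every
face of `X₁` through `0` contains `F₁`, so near `0` the space `X₁` is invariant under translation
along `E₁`, and likewise `X₂` along `E₂` (`eventually_mem_space_iff`). Hence near `0` the set `X₁ ∩
X₂` is the direct sum of the slices `X₂ ∩ E₁` and `X₁ ∩ E₂`, and each slice is the support `Aᵢ` of a
fan of pointed cones, the tangent cones of faces of `X₁ ∩ X₂` (`eventually_mem_slice_iff`).
Genericity says that the height `⟪·, a⟫` vanishes identically on no nonzero cone.

On such a fan every point splits continuously as `y = p y + q y`, with the height positive on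
nonzero `p y` and negative on nonzero `q y` (`PointedFan.splits`). Given a splitting, for small `δ /
r` the pair (cone / link) is homeomorphic to `{‖p‖ ≤ 1, ‖q‖ ≤ 1}` relative to `{‖p‖ = 1}`
(`isHomeomorphic_splitPair`), a model free of the parameters. For the product splitting on `A₁ × A₂`
with the maximum norm, this model is literally the product of the two models (`splitPair_prod`),
which gives the theorem.

Only the restrictions of the height to `E₁` and `E₂` enter, so orthogonality plays no role. If `aᵢ =
0`, genericity leaves only the zero cone in the slice, so `0` is isolated there. -/

open Filter Topology

/-- A continuous decomposition `y = p y + q y` of the points of `A`, compatible with independent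
nonnegative rescaling of both parts, such that `f` is positive on the nonzero values of `p` and
negative on the nonzero values of `q`. -/
structure SignSplitting {V : Type*} [NormedAddCommGroup V] [NormedSpace ℝ V]
    (A : Set V) (f : V →L[ℝ] ℝ) (p q : V → V) : Prop where
  continuousOn_pos : ContinuousOn p A
  continuousOn_neg : ContinuousOn q A
  add_eq : ∀ y ∈ A, p y + q y = y
  comb_mem : ∀ y ∈ A, ∀ s t : ℝ, 0 ≤ s → 0 ≤ t → s • p y + t • q y ∈ A
  pos_comb : ∀ y ∈ A, ∀ s t : ℝ, 0 ≤ s → 0 ≤ t → p (s • p y + t • q y) = s • p y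
  neg_comb : ∀ y ∈ A, ∀ s t : ℝ, 0 ≤ s → 0 ≤ t → q (s • p y + t • q y) = t • q y
  pos : ∀ y ∈ A, p y ≠ 0 → 0 < f (p y)
  neg : ∀ y ∈ A, q y ≠ 0 → f (q y) < 0

namespace SignSplitting

variable {V : Type*} [NormedAddCommGroup V] [NormedSpace ℝ V]
  {A : Set V} {f : V →L[ℝ] ℝ} {p q : V → V}

theorem swap (h : SignSplitting A f p q) : SignSplitting A (-f) q p where
  continuousOn_pos := h.continuousOn_neg
  continuousOn_neg := h.continuousOn_pos
  add_eq y hy := by rw [add_comm, h.add_eq y hy]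
  comb_mem y hy s t hs ht := by rw [add_comm]; exact h.comb_mem y hy t s ht hs
  pos_comb y hy s t hs ht := by rw [add_comm]; exact h.neg_comb y hy t s ht hs
  neg_comb y hy s t hs ht := by rw [add_comm]; exact h.pos_comb y hy t s ht hs
  pos y hy h0 := by simpa using h.neg y hy h0
  neg y hy h0 := by simpa using h.pos y hy h0

end SignSplitting

/-! ### Fans of pointed cones and the existence of sign splittings -/

section Fan

variable {E : Type*} [NormedAddCommGroup E] [InnerProductSpace ℝ E]

/-- A polyhedral cone: a finite intersection of closed linear half-spaces. -/
def IsPolyhedralCone (σ : Set E) : Prop :=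
  ∃ H : Finset E, σ = {y | ∀ h ∈ H, ⟪h, y⟫ ≤ 0}

namespace IsPolyhedralCone

variable {σ : Set E}

theorem zero_mem (hσ : IsPolyhedralCone σ) : (0 : E) ∈ σ := by
  obtain ⟨H, rfl⟩ := hσ
  simp

theorem add_mem (hσ : IsPolyhedralCone σ) {x y : E} (hx : x ∈ σ) (hy : y ∈ σ) : x + y ∈ σ := by
  obtain ⟨H, rfl⟩ := hσ
  intro h hh
  rw [inner_add_right]
  exact add_nonpos (hx h hh) (hy h hh)

theorem smul_mem (hσ : IsPolyhedralCone σ) {x : E} (hx : x ∈ σ) {t : ℝ} (ht : 0 ≤ t) :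
    t • x ∈ σ := by
  obtain ⟨H, rfl⟩ := hσ
  intro h hh
  rw [real_inner_smul_right]
  exact mul_nonpos_of_nonneg_of_nonpos ht (hx h hh)

theorem isClosed (hσ : IsPolyhedralCone σ) : IsClosed σ := by
  obtain ⟨H, rfl⟩ := hσ
  have : {y : E | ∀ h ∈ H, ⟪h, y⟫ ≤ 0} = ⋂ h ∈ H, {y | ⟪h, y⟫ ≤ 0} := by
    ext; simp
  rw [this]
  exact isClosed_biInter fun h _ => isClosed_le (by fun_prop) continuous_const

/-- How far one can move from a point of a polyhedral cone against the direction `v`. -/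
theorem exists_pull (hσ : IsPolyhedralCone σ) {v : E} (hv : v ∈ σ) (hv' : -v ∉ σ) :
    ∃ t : E → ℝ, Continuous t ∧ ∀ y ∈ σ, ∀ s : ℝ, y - s • v ∈ σ ↔ s ≤ t y := by
  classical
  obtain ⟨H, rfl⟩ := hσ
  -- Otherwise all defining functionals vanish on `v`, and `-v` lies in the cone.
  have hne : (H.filter fun h => ⟪h, v⟫ < 0).Nonempty := by
    by_contra hcon
    rw [Finset.not_nonempty_iff_eq_empty, Finset.filter_eq_empty_iff] at hcon
    refine hv' fun h hh => ?_
    have := hcon hh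
    rw [inner_neg_right]
    linarith
  -- The constraint `⟪h, y⟫ - s * ⟪h, v⟫ ≤ 0` bounds `s` from above only when `⟪h, v⟫ < 0`, and then
  -- by the quotient.
  refine ⟨fun y => (H.filter fun h => ⟪h, v⟫ < 0).inf' hne fun h => ⟪h, y⟫ / ⟪h, v⟫,
    Continuous.finset_inf'_apply hne fun h _ => by fun_prop, fun y hy s => ?_⟩
  rw [Finset.le_inf'_iff]
  constructor
  · intro hs h hh
    obtain ⟨hH, hlt⟩ := Finset.mem_filter.1 hh
    have := hs h hH
    rw [inner_sub_right, real_inner_smul_right] at this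
    rw [le_div_iff_of_neg hlt]
    linarith
  · intro hs h hh
    rw [inner_sub_right, real_inner_smul_right]
    rcases (hv h hh).lt_or_eq with hlt | heq
    · have := hs h (Finset.mem_filter.2 ⟨hh, hlt⟩)
      rw [le_div_iff_of_neg hlt] at this
      linarith
    · rw [heq]
      simpa using hy h hh

end IsPolyhedralCone

/-- A finite set of pointed polyhedral cones that is closed under passing to minimal faces and in
which the intersection of any two cones is extreme in both. -/
structure PointedFan (𝓕 : Set (Set E)) : Prop where
  finite : 𝓕.Finite
  cone : ∀ σ ∈ 𝓕, IsPolyhedralCone σ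
  pointed : ∀ σ ∈ 𝓕, ∀ y ∈ σ, -y ∈ σ → y = 0
  face : ∀ σ ∈ 𝓕, ∀ x ∈ σ, {y | y ∈ σ ∧ ∃ η : ℝ, 0 < η ∧ x - η • y ∈ σ} ∈ 𝓕
  extreme : ∀ σ ∈ 𝓕, ∀ τ ∈ 𝓕, ∀ x ∈ σ, ∀ y ∈ σ, x + y ∈ τ → x ∈ τ

theorem continuousOn_sUnion_of_finite {X Y : Type*} [TopologicalSpace X] [TopologicalSpace Y]
    {𝓕 : Set (Set X)} (hfin : 𝓕.Finite) {f : X → Y} (hcl : ∀ σ ∈ 𝓕, IsClosed σ)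
    (hf : ∀ σ ∈ 𝓕, ContinuousOn f σ) : ContinuousOn f (⋃₀ 𝓕) := by
  have := hfin.to_subtype
  rw [Set.sUnion_eq_iUnion]
  exact (locallyFinite_of_finite _).continuousOn_iUnion (fun σ => hcl σ σ.2) fun σ => hf σ σ.2

namespace PointedFan

variable {𝓕 : Set (Set E)}

theorem isClosed_sUnion (h : PointedFan 𝓕) : IsClosed (⋃₀ 𝓕) := by
  rw [Set.sUnion_eq_biUnion]
  exact h.finite.isClosed_biUnion fun σ hσ => (h.cone σ hσ).isClosed

theorem subfan (h : PointedFan 𝓕) (v : E) : PointedFan {σ ∈ 𝓕 | v ∉ σ} where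
  finite := h.finite.subset fun _ hσ => hσ.1
  cone σ hσ := h.cone σ hσ.1
  pointed σ hσ := h.pointed σ hσ.1
  face σ hσ x hx := ⟨h.face σ hσ.1 x hx, fun hv => hσ.2 hv.1⟩
  extreme σ hσ τ hτ := h.extreme σ hσ.1 τ hτ.1

/-- The pulls in the single cones agree on overlaps: both summands of `y = (y - T σ y • v) + T σ y •
v` lie in `σ`, so by extremeness they lie in every cone of the fan that contains `y`. For the same
reason the pull is zero at points that also lie in a cone without `v`. -/
theorem exists_pull (h : PointedFan 𝓕) {v : E} (hv : v ≠ 0) :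
    ∃ t : E → ℝ, ContinuousOn t (⋃₀ 𝓕) ∧ (∀ σ ∈ 𝓕, v ∉ σ → ∀ y ∈ σ, t y = 0) ∧
      ∀ σ ∈ 𝓕, v ∈ σ → ∀ y ∈ σ, ∀ s : ℝ, y - s • v ∈ σ ↔ s ≤ t y := by
  classical
  have hex : ∀ σ : Set E, ∃ t : E → ℝ, σ ∈ 𝓕 → v ∈ σ → Continuous t ∧
      ∀ y ∈ σ, ∀ s : ℝ, y - s • v ∈ σ ↔ s ≤ t y := fun σ => by
    by_cases hσ : σ ∈ 𝓕 ∧ v ∈ σ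
    · obtain ⟨t, ht⟩ := (h.cone σ hσ.1).exists_pull hσ.2 fun h' => hv (h.pointed σ hσ.1 v hσ.2 h')
      exact ⟨t, fun _ _ => ht⟩
    · exact ⟨0, fun h1 h2 => absurd ⟨h1, h2⟩ hσ⟩
  choose T hT using hex
  have hnonneg : ∀ σ ∈ 𝓕, v ∈ σ → ∀ y ∈ σ, 0 ≤ T σ y := fun σ hσ hvσ y hy =>
    ((hT σ hσ hvσ).2 y hy 0).1 (by simpa using hy)
  have hle : ∀ σ ∈ 𝓕, v ∈ σ → ∀ τ ∈ 𝓕, v ∈ τ → ∀ y, y ∈ σ → y ∈ τ → T σ y ≤ T τ y := by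
    intro σ hσ hvσ τ hτ hvτ y hyσ hyτ
    rw [← (hT τ hτ hvτ).2 y hyτ]
    refine h.extreme σ hσ τ hτ _ (((hT σ hσ hvσ).2 y hyσ _).2 le_rfl) (T σ y • v)
      ((h.cone σ hσ).smul_mem hvσ (hnonneg σ hσ hvσ y hyσ)) (by simpa using hyτ)
  let t : E → ℝ := fun y => if hy : ∃ σ ∈ 𝓕, v ∈ σ ∧ y ∈ σ then T hy.choose y else 0
  have ht : ∀ σ ∈ 𝓕, v ∈ σ → ∀ y ∈ σ, t y = T σ y := by
    intro σ hσ hvσ y hyσ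
    have hy : ∃ σ ∈ 𝓕, v ∈ σ ∧ y ∈ σ := ⟨σ, hσ, hvσ, hyσ⟩
    simp only [t, dif_pos hy]
    obtain ⟨h1, h2, h3⟩ := hy.choose_spec
    exact le_antisymm (hle _ h1 h2 _ hσ hvσ _ h3 hyσ) (hle _ hσ hvσ _ h1 h2 _ hyσ h3)
  have ht0 : ∀ σ ∈ 𝓕, v ∉ σ → ∀ y ∈ σ, t y = 0 := by
    intro σ hσ hvσ y hyσ
    by_cases hy : ∃ σ ∈ 𝓕, v ∈ σ ∧ y ∈ σ
    · obtain ⟨τ, hτ, hvτ, hyτ⟩ := hy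
      rw [ht τ hτ hvτ y hyτ]
      by_contra hne
      have hpos := (hnonneg τ hτ hvτ y hyτ).lt_of_ne' hne
      have hmem := h.extreme τ hτ σ hσ (T τ y • v) ((h.cone τ hτ).smul_mem hvτ hpos.le) _
        (((hT τ hτ hvτ).2 y hyτ _).2 le_rfl) (by simpa using hyσ)
      apply hvσ
      simpa [smul_smul, inv_mul_cancel₀ hne] using
        (h.cone σ hσ).smul_mem hmem (inv_nonneg.2 hpos.le)
    · simp only [t, dif_neg hy]
  refine ⟨t, continuousOn_sUnion_of_finite h.finite (fun σ hσ => (h.cone σ hσ).isClosed)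
    fun σ hσ => ?_, ht0, fun σ hσ hvσ y hy s => ?_⟩
  · by_cases hvσ : v ∈ σ
    · exact (hT σ hσ hvσ).1.continuousOn.congr fun y hy => ht σ hσ hvσ y hy
    · exact continuousOn_const.congr fun y hy => ht0 σ hσ hvσ y hy
  · rw [ht σ hσ hvσ y hy]
    exact (hT σ hσ hvσ).2 y hy s

/-- A splitting of the support of a fan that preserves all its cones. -/
def Splits (𝓕 : Set (Set E)) (f : E →L[ℝ] ℝ) : Prop :=
  ∃ p q : E → E, SignSplitting (⋃₀ 𝓕) f p q ∧ ∀ σ ∈ 𝓕, ∀ y ∈ σ, p y ∈ σ ∧ q y ∈ σ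

theorem Splits.neg {f : E →L[ℝ] ℝ} (h : Splits 𝓕 f) : Splits 𝓕 (-f) := by
  obtain ⟨p, q, h1, h2⟩ := h
  exact ⟨q, p, h1.swap, fun σ hσ y hy => (h2 σ hσ y hy).symm⟩

/-- Pull `y` against `v` until it reaches a face without `v`, split the residue there, and add the
removed multiple of `v`, on which `f` is nonnegative, to the positive part. -/
theorem splits_of_subfan (h : PointedFan 𝓕) {f : E →L[ℝ] ℝ} {v : E} (hv : 0 < f v)
    (hsub : Splits {σ ∈ 𝓕 | v ∉ σ} f) : Splits 𝓕 f := by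
  have hv0 : v ≠ 0 := by rintro rfl; simp at hv
  obtain ⟨t, htc, ht0, ht⟩ := h.exists_pull hv0
  obtain ⟨p, q, hs, hpq⟩ := hsub
  have htn : ∀ σ ∈ 𝓕, ∀ y ∈ σ, 0 ≤ t y := fun σ hσ y hy => by
    by_cases hvσ : v ∈ σ
    · exact (ht σ hσ hvσ y hy 0).1 (by simpa using hy)
    · exact (ht0 σ hσ hvσ y hy).ge
  -- For `v ∈ σ`, `ρ` is the minimal face of `σ` containing the residue; if it contained `v`, one
  -- could pull further.
  have hres : ∀ σ ∈ 𝓕, ∀ y ∈ σ, ∃ ρ ∈ 𝓕, v ∉ ρ ∧ y - t y • v ∈ ρ ∧ ρ ⊆ σ := by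
    intro σ hσ y hy
    by_cases hvσ : v ∈ σ
    · have hr : y - t y • v ∈ σ := (ht σ hσ hvσ y hy _).2 le_rfl
      refine ⟨_, h.face σ hσ _ hr, ?_, ⟨hr, 1, one_pos, by simpa using (h.cone σ hσ).zero_mem⟩,
        fun z hz => hz.1⟩
      rintro ⟨-, η, hη, hmem⟩
      rw [sub_sub, ← add_smul, ht σ hσ hvσ y hy] at hmem
      linarith
    · exact ⟨σ, hσ, hvσ, by simpa [ht0 σ hσ hvσ y hy] using hy, subset_rfl⟩
  have hmemσ : ∀ σ ∈ 𝓕, ∀ y ∈ σ, t y • v ∈ σ := fun σ hσ y hy => by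
    by_cases hvσ : v ∈ σ
    · exact (h.cone σ hσ).smul_mem hvσ (htn σ hσ y hy)
    · simpa [ht0 σ hσ hvσ y hy] using (h.cone σ hσ).zero_mem
  -- Uniqueness of the decomposition: if the pull exceeded `c`, a positive multiple of `v` would be
  -- a summand of `w` in `σ`, and extremeness would put `v` into `ρ`.
  have htcomb : ∀ σ ∈ 𝓕, ∀ ρ ∈ 𝓕, v ∉ ρ → ∀ w ∈ ρ, w ∈ σ → ∀ c : ℝ, 0 ≤ c → c • v ∈ σ →
      t (c • v + w) = c := by
    intro σ hσ ρ hρ hvρ w hwρ hwσ c hc hcv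
    rcases hc.eq_or_lt with rfl | hpos
    · simpa using ht0 ρ hρ hvρ w hwρ
    have hvσ : v ∈ σ := by
      simpa [smul_smul, inv_mul_cancel₀ hpos.ne'] using
        (h.cone σ hσ).smul_mem hcv (inv_nonneg.2 hc)
    have hmem : c • v + w ∈ σ := (h.cone σ hσ).add_mem hcv hwσ
    refine le_antisymm ?_ ((ht σ hσ hvσ _ hmem c).1 (by simpa using hwσ))
    by_contra! hlt
    have h1 : w - (t (c • v + w) - c) • v ∈ σ := by
      have := (ht σ hσ hvσ _ hmem _).2 le_rfl
      convert this using 1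
      module
    have h2 := h.extreme σ hσ ρ hρ _ ((h.cone σ hσ).smul_mem hvσ (sub_nonneg.2 hlt.le)) _ h1
      (by simpa using hwρ)
    apply hvρ
    simpa [smul_smul, inv_mul_cancel₀ (sub_pos.2 hlt).ne'] using
        (h.cone ρ hρ).smul_mem h2 (inv_nonneg.2 (sub_pos.2 hlt).le)
  have hresU : ∀ y ∈ ⋃₀ 𝓕, y - t y • v ∈ ⋃₀ {σ ∈ 𝓕 | v ∉ σ} := by
    rintro y ⟨σ, hσ, hy⟩
    obtain ⟨ρ, hρ, hvρ, hr, -⟩ := hres σ hσ y hy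
    exact ⟨ρ, ⟨hρ, hvρ⟩, hr⟩
  have hrc : ContinuousOn (fun y => y - t y • v) (⋃₀ 𝓕) :=
    continuousOn_id.sub (htc.smul continuousOn_const)
  have hcombσ : ∀ σ ∈ 𝓕, ∀ y ∈ σ, (t y • v + p (y - t y • v) ∈ σ) ∧ q (y - t y • v) ∈ σ := by
    intro σ hσ y hy
    obtain ⟨ρ, hρ, hvρ, hr, hρσ⟩ := hres σ hσ y hy
    have := hpq ρ ⟨hρ, hvρ⟩ _ hr
    exact ⟨(h.cone σ hσ).add_mem (hmemσ σ hσ y hy) (hρσ this.1), hρσ this.2⟩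
  have key : ∀ y ∈ ⋃₀ 𝓕, ∀ s u : ℝ, 0 ≤ s → 0 ≤ u →
      t (s • (t y • v + p (y - t y • v)) + u • q (y - t y • v)) = s * t y := by
    rintro y ⟨σ, hσ, hy⟩ s u hs hu
    obtain ⟨ρ, hρ, hvρ, hr, hρσ⟩ := hres σ hσ y hy
    have hm := hpq ρ ⟨hρ, hvρ⟩ _ hr
    have hw : s • p (y - t y • v) + u • q (y - t y • v) ∈ ρ :=
      (h.cone ρ hρ).add_mem ((h.cone ρ hρ).smul_mem hm.1 hs) ((h.cone ρ hρ).smul_mem hm.2 hu)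
    have := htcomb σ hσ ρ hρ hvρ _ hw (hρσ hw) (s * t y) (mul_nonneg hs (htn σ hσ y hy))
      (by rw [mul_smul]; exact (h.cone σ hσ).smul_mem (hmemσ σ hσ y hy) hs)
    rw [← this]
    congr 1
    module
  have key2 : ∀ y ∈ ⋃₀ 𝓕, ∀ s u : ℝ, 0 ≤ s → 0 ≤ u →
      (s • (t y • v + p (y - t y • v)) + u • q (y - t y • v)) -
        t (s • (t y • v + p (y - t y • v)) + u • q (y - t y • v)) • v =
      s • p (y - t y • v) + u • q (y - t y • v) := by
    intro y hy s u hs hu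
    rw [key y hy s u hs hu]
    module
  refine ⟨fun y => t y • v + p (y - t y • v), fun y => q (y - t y • v), ?_, hcombσ⟩
  constructor
  · exact (htc.smul continuousOn_const).add (hs.continuousOn_pos.comp hrc hresU)
  · exact hs.continuousOn_neg.comp hrc hresU
  · intro y hy
    rw [add_assoc, hs.add_eq _ (hresU y hy)]
    abel
  · rintro y ⟨σ, hσ, hy⟩ s u hs hu
    have := hcombσ σ hσ y hy
    exact ⟨σ, hσ, (h.cone σ hσ).add_mem ((h.cone σ hσ).smul_mem this.1 hs)
      ((h.cone σ hσ).smul_mem this.2 hu)⟩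
  · intro y hy s u hs' hu
    rw [key2 y hy s u hs' hu, key y hy s u hs' hu, hs.pos_comb _ (hresU y hy) s u hs' hu]
    module
  · intro y hy s u hs' hu
    simp only [key2 y hy s u hs' hu, hs.neg_comb _ (hresU y hy) s u hs' hu]
  · rintro y hy hne
    have hr := hresU y hy
    obtain ⟨σ, hσ, hyσ⟩ := hy
    have h1 : 0 ≤ f (t y • v) := by
      rw [map_smul, smul_eq_mul]
      exact mul_nonneg (htn σ hσ y hyσ) hv.le
    rw [map_add]
    by_cases hp : p (y - t y • v) = 0
    · have hty : t y ≠ 0 := fun h0 => hne (by rw [hp, h0, zero_smul, add_zero])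
      simp only [hp, map_zero, add_zero, map_smul, smul_eq_mul]
      exact mul_pos ((htn σ hσ y hyσ).lt_of_ne' hty) hv
    · linarith [hs.pos _ hr hp]
  · exact fun y hy hne => hs.neg _ (hresU y hy) hne

/-- Induction on the number of cones: choose `v` in some cone with `f v ≠ 0`. The cones without `v`
form a smaller fan, and the case `f v < 0` reduces to `f v > 0` by exchanging the two parts. -/
theorem splits (h : PointedFan 𝓕) {f : E →L[ℝ] ℝ}
    (hf : ∀ σ ∈ 𝓕, (∀ y ∈ σ, f y = 0) → σ ⊆ {0}) : Splits 𝓕 f := by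
  induction hn : 𝓕.ncard using Nat.strong_induction_on generalizing 𝓕 with
  | _ n ih =>
    by_cases hall : ∀ σ ∈ 𝓕, σ ⊆ {0}
    · refine ⟨id, fun _ => 0, ?_, fun σ hσ y hy => ⟨hy, (h.cone σ hσ).zero_mem⟩⟩
      have h0 : ∀ y ∈ ⋃₀ 𝓕, y = 0 := fun y ⟨σ, hσ, hy⟩ => hall σ hσ hy
      constructor
      · exact continuousOn_id
      · exact continuousOn_const
      · simp
      · rintro y hy s t hs ht
        simpa [h0 y hy] using h0 y hy ▸ hy
      · simp
      · simp
      · intro y hy hne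
        exact absurd (h0 y hy) hne
      · simp
    · push Not at hall
      obtain ⟨σ, hσ, hσ0⟩ := hall
      obtain ⟨v, hvσ, hv⟩ : ∃ v ∈ σ, f v ≠ 0 := by
        by_contra! hcon
        exact hσ0 (hf σ hσ hcon)
      have hlt : {τ ∈ 𝓕 | v ∉ τ}.ncard < 𝓕.ncard :=
        Set.ncard_lt_ncard ⟨fun τ hτ => hτ.1, fun hsub => (hsub hσ).2 hvσ⟩ h.finite
      have hsplit := ih _ (hn ▸ hlt) (h.subfan v) (fun τ hτ => hf τ hτ.1) rfl
      rcases hv.lt_or_gt with hneg | hpos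
      · have := h.splits_of_subfan (f := -f) (v := v) (by simpa using hneg) hsplit.neg
        simpa using this.neg
      · exact h.splits_of_subfan hpos hsplit

end PointedFan

end Fan

/-! ### Homeomorphic pairs -/

namespace SpacePair.IsHomeomorphic

variable {α β γ δ : Type*} [TopologicalSpace α] [TopologicalSpace β] [TopologicalSpace γ]
  [TopologicalSpace δ]

theorem symm {P : SpacePair α} {Q : SpacePair β} (h : P.IsHomeomorphic Q) :
    Q.IsHomeomorphic P := by
  obtain ⟨e, he⟩ := h
  exact ⟨e.symm, fun x => by simpa using (he (e.symm x)).symm⟩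

theorem trans {P : SpacePair α} {Q : SpacePair β} {R : SpacePair γ} (h : P.IsHomeomorphic Q)
    (h' : Q.IsHomeomorphic R) : P.IsHomeomorphic R := by
  obtain ⟨e, he⟩ := h
  obtain ⟨e', he'⟩ := h'
  exact ⟨e.trans e', fun x => (he x).trans (he' (e x))⟩

theorem prod {P : SpacePair α} {Q : SpacePair β} {P' : SpacePair γ} {Q' : SpacePair δ}
    (h : P.IsHomeomorphic P') (h' : Q.IsHomeomorphic Q') :
    (P.prod Q).IsHomeomorphic (P'.prod Q') := by
  obtain ⟨e, he⟩ := h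
  obtain ⟨e', he'⟩ := h'
  refine ⟨(Homeomorph.Set.prod P.space Q.space).trans
    ((e.prodCongr e').trans (Homeomorph.Set.prod P'.space Q'.space).symm), ?_⟩
  rintro ⟨⟨x, y⟩, hx, hy⟩
  have h1 := he ⟨x, hx⟩
  have h2 := he' ⟨y, hy⟩
  have h3 : (e ⟨x, hx⟩ : γ) ∈ P'.space := (e ⟨x, hx⟩).2
  have h4 : (e' ⟨y, hy⟩ : δ) ∈ Q'.space := (e' ⟨y, hy⟩).2
  change (x ∈ P.sub ∧ y ∈ Q.space ∨ x ∈ P.space ∧ y ∈ Q.sub) ↔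
    ((e ⟨x, hx⟩ : γ) ∈ P'.sub ∧ (e' ⟨y, hy⟩ : δ) ∈ Q'.space ∨
      (e ⟨x, hx⟩ : γ) ∈ P'.space ∧ (e' ⟨y, hy⟩ : δ) ∈ Q'.sub)
  simp only at h1 h2
  rw [h1, h2]
  simp only [hx, hy, h3, h4]

theorem of_bijOn [T2Space β] {P : SpacePair α} {Q : SpacePair β} (hP : IsCompact P.space)
    {φ : α → β} (hφ : ContinuousOn φ P.space) (hb : Set.BijOn φ P.space Q.space)
    (hsub : ∀ x ∈ P.space, x ∈ P.sub ↔ φ x ∈ Q.sub) : P.IsHomeomorphic Q := by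
  have := isCompact_iff_compactSpace.1 hP
  have hc : Continuous (hb.equiv φ) := by
    apply Continuous.subtype_mk
    exact continuousOn_iff_continuous_domRestrict.1 hφ
  exact ⟨hc.homeoOfEquivCompactToT2, fun x => hsub x x.2⟩

end SpacePair.IsHomeomorphic

/-! ### The parameter-free model of the cone / link pair -/

/-- The pair of the points whose positive and negative parts have norm at most `1`, relative to
those whose positive part has norm `1`. -/
def splitPair {V : Type*} [NormedAddCommGroup V] (A : Set V) (p q : V → V) : SpacePair V where
  space := {v | v ∈ A ∧ ‖p v‖ ≤ 1 ∧ ‖q v‖ ≤ 1}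
  sub := {v | v ∈ A ∧ ‖p v‖ = 1 ∧ ‖q v‖ ≤ 1}

/-- The value has norm at most `|g x|`, which tends to `0` at a zero of `k`; elsewhere the formula
is visibly continuous. -/
theorem continuousOn_rescale {X V : Type*} [TopologicalSpace X] [NormedAddCommGroup V]
    [NormedSpace ℝ V] {A : Set X} {g : X → ℝ} {k : X → V} (hg : ContinuousOn g A)
    (hk : ContinuousOn k A) (h0 : ∀ x ∈ A, k x = 0 → g x = 0) :
    ContinuousOn (fun x => (g x / ‖k x‖) • k x) A := by
  intro x hx
  by_cases hkx : k x = 0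
  · rw [ContinuousWithinAt, hkx, smul_zero]
    apply squeeze_zero_norm (a := fun y => |g y|) (fun y => ?_)
    · have := (hg x hx).abs
      rwa [ContinuousWithinAt, h0 x hx hkx, abs_zero] at this
    · rw [norm_smul, norm_div, norm_norm, Real.norm_eq_abs]
      rcases eq_or_ne (‖k y‖) 0 with hy | hy
      · simp [hy]
      · rw [div_mul_cancel₀ _ hy]
  · exact ((hg x hx).div (hk x hx).norm (norm_ne_zero_iff.2 hkx)).smul (hk x hx)

namespace SignSplitting

variable {V : Type*} [NormedAddCommGroup V] [NormedSpace ℝ V]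
  {A : Set V} {f : V →L[ℝ] ℝ} {p q : V → V}

theorem smul_mem (h : SignSplitting A f p q) {y : V} (hy : y ∈ A) {t : ℝ} (ht : 0 ≤ t) :
    t • y ∈ A := by
  have := h.comb_mem y hy t t ht ht
  rwa [← smul_add, h.add_eq y hy] at this

theorem pos_smul (h : SignSplitting A f p q) {y : V} (hy : y ∈ A) {t : ℝ} (ht : 0 ≤ t) :
    p (t • y) = t • p y := by
  have := h.pos_comb y hy t t ht ht
  rwa [← smul_add, h.add_eq y hy] at this

theorem neg_smul (h : SignSplitting A f p q) {y : V} (hy : y ∈ A) {t : ℝ} (ht : 0 ≤ t) :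
    q (t • y) = t • q y := by
  have := h.neg_comb y hy t t ht ht
  rwa [← smul_add, h.add_eq y hy] at this

theorem pos_mem (h : SignSplitting A f p q) {y : V} (hy : y ∈ A) : p y ∈ A := by
  simpa using h.comb_mem y hy 1 0 zero_le_one le_rfl

theorem neg_pos (h : SignSplitting A f p q) {y : V} (hy : y ∈ A) : q (p y) = 0 := by
  simpa using h.neg_comb y hy 1 0 zero_le_one le_rfl

/-- On positive parts, `f` grows at least linearly. -/
theorem exists_le_pos [FiniteDimensional ℝ V] (h : SignSplitting A f p q) (hA : IsClosed A) :
    ∃ m : ℝ, 0 < m ∧ ∀ y ∈ A, m * ‖p y‖ ≤ f (p y) := by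
  -- All normalised positive parts lie in this compact set, on which `f` is positive.
  let S : Set V := {y ∈ A | q y = 0} ∩ Metric.sphere 0 1
  have hScl : IsClosed {y ∈ A | q y = 0} :=
    h.continuousOn_neg.preimage_isClosed_of_isClosed hA isClosed_singleton
  have hS : IsCompact S := (isCompact_sphere 0 1).inter_left hScl
  have hpS : ∀ y ∈ A, p y ≠ 0 → ‖p y‖⁻¹ • p y ∈ S := by
    intro y hy hne
    refine ⟨⟨h.smul_mem (h.pos_mem hy) (by positivity), ?_⟩, ?_⟩
    · rw [h.neg_smul (h.pos_mem hy) (by positivity), h.neg_pos hy, smul_zero]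
    · rw [mem_sphere_zero_iff_norm, norm_smul, norm_inv, norm_norm,
        inv_mul_cancel₀ (norm_ne_zero_iff.2 hne)]
  rcases S.eq_empty_or_nonempty with he | hne
  · refine ⟨1, one_pos, fun y hy => ?_⟩
    by_cases h0 : p y = 0
    · simp [h0]
    · exact absurd (hpS y hy h0) (by simp [he])
  · obtain ⟨z, ⟨⟨hzA, hzq⟩, hz1⟩, hmin⟩ := hS.exists_isMinOn hne f.continuous.continuousOn
    have hz : p z = z := by simpa [hzq] using h.add_eq z hzA
    refine ⟨f z, ?_, fun y hy => ?_⟩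
    · rw [← hz]
      apply h.pos z hzA
      rw [hz]
      rintro rfl
      simp at hz1
    · by_cases h0 : p y = 0
      · simp [h0]
      · have := hmin (hpS y hy h0)
        simp only [Set.mem_ofPred_eq, map_smul, smul_eq_mul] at this
        rwa [inv_mul_eq_div, le_div_iff₀ (norm_pos_iff.2 h0)] at this

section Model

variable {W : Type*} [NormedAddCommGroup W] [NormedSpace ℝ W]

/-- The part of `A` in a unit ball and a slab is homeomorphic to the part given by bounds on the
positive and negative parts, if positive and negative parts hit the slab before the ball. -/
theorem isHomeomorphic_splitPair [FiniteDimensional ℝ V] (h : SignSplitting A f p q)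
    (hA : IsClosed A) (J : V →L[ℝ] W)
    {c : ℝ} (hc : 0 < c) (hJ : ∀ y ∈ A, c * ‖y‖ ≤ ‖J y‖)
    (hpos : ∀ y ∈ A, p y ≠ 0 → ‖J (p y)‖ < f (p y))
    (hneg : ∀ y ∈ A, q y ≠ 0 → ‖J (q y)‖ < -f (q y)) :
    SpacePair.IsHomeomorphic (⟨{v | v ∈ A ∧ ‖J v‖ ≤ 1 ∧ |f v| ≤ 1},
      {v | v ∈ A ∧ ‖J v‖ ≤ 1 ∧ f v = 1}⟩ : SpacePair V) (splitPair A p q) := by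
  -- `α` and `β` are the intended norms of the two parts of the image. They are homogeneous, vanish
  -- exactly with `p` and `q`, and satisfy `α - β = f - ‖J ·‖`, so that `β ≤ α` singles out the
  -- directions that meet the slab's upper wall no later than the ball. `G` is the gauge of ball and
  -- slab, and `M` that of the region `α ≤ 1`, `β ≤ 1`.
  let α : V → ℝ := fun y => f (p y) - ‖J (p y)‖
  let β : V → ℝ := fun y => -f (q y) + ‖J y‖ - ‖J (p y)‖
  let G : V → ℝ := fun y => max |f y| ‖J y‖
  let M : V → ℝ := fun y => max (α y) (β y)
  have hαβ : ∀ y ∈ A, α y - β y = f y - ‖J y‖ := by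
    intro y hy
    have : f y = f (p y) + f (q y) := by rw [← map_add, h.add_eq y hy]
    simp only [α, β, this]
    ring
  have hα0 : ∀ y ∈ A, p y = 0 → α y = 0 := fun y hy h0 => by simp [α, h0]
  have hβ0 : ∀ y ∈ A, q y = 0 → β y = 0 := fun y hy h0 => by
    have : p y = y := by simpa [h0] using h.add_eq y hy
    simp [β, h0, this]
  have hαp : ∀ y ∈ A, p y ≠ 0 → 0 < α y := fun y hy h0 => sub_pos.2 (hpos y hy h0)
  have hβp : ∀ y ∈ A, q y ≠ 0 → 0 < β y := fun y hy h0 => by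
    have h1 := hneg y hy h0
    have h2 : ‖J (p y)‖ ≤ ‖J y‖ + ‖J (q y)‖ := by
      have : J (p y) = J y - J (q y) := by rw [← map_sub]; congr 1; nth_rw 2 [← h.add_eq y hy]; abel
      rw [this]
      exact norm_sub_le _ _
    simp only [β]
    linarith
  have hαn : ∀ y ∈ A, 0 ≤ α y := fun y hy => by
    by_cases h0 : p y = 0
    · exact (hα0 y hy h0).ge
    · exact (hαp y hy h0).le
  have hβn : ∀ y ∈ A, 0 ≤ β y := fun y hy => by
    by_cases h0 : q y = 0
    · exact (hβ0 y hy h0).ge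
    · exact (hβp y hy h0).le
  have hG0 : ∀ y ∈ A, G y = 0 → y = 0 := fun y hy h0 => by
    have h1 : ‖J y‖ ≤ 0 := h0 ▸ le_max_right _ _
    have h2 := hJ y hy
    exact norm_le_zero_iff.1 (by by_contra! h3; nlinarith)
  have hGn : ∀ y, 0 ≤ G y := fun y => (abs_nonneg _).trans (le_max_left _ _)
  have hMn : ∀ y ∈ A, 0 ≤ M y := fun y hy => (hαn y hy).trans (le_max_left _ _)
  have hM0 : ∀ y ∈ A, M y = 0 → y = 0 := fun y hy h0 => by
    have h1 : α y ≤ 0 := h0 ▸ le_max_left _ _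
    have h2 : β y ≤ 0 := h0 ▸ le_max_right _ _
    have h3 : p y = 0 := by by_contra h3; linarith [hαp y hy h3]
    have h4 : q y = 0 := by by_contra h4; linarith [hβp y hy h4]
    rw [← h.add_eq y hy, h3, h4, add_zero]
  have hαs : ∀ y ∈ A, ∀ t : ℝ, 0 ≤ t → α (t • y) = t * α y := fun y hy t ht => by
    simp only [α, h.pos_smul hy ht, map_smul, norm_smul, Real.norm_of_nonneg ht, smul_eq_mul]
    ring
  have hβs : ∀ y ∈ A, ∀ t : ℝ, 0 ≤ t → β (t • y) = t * β y := fun y hy t ht => by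
    simp only [β, h.pos_smul hy ht, h.neg_smul hy ht, map_smul, norm_smul,
      Real.norm_of_nonneg ht, smul_eq_mul]
    ring
  have hGs : ∀ y, ∀ t : ℝ, 0 ≤ t → G (t • y) = t * G y := fun y t ht => by
    simp only [G, map_smul, norm_smul, Real.norm_of_nonneg ht, smul_eq_mul, abs_mul,
      abs_of_nonneg ht, mul_max_of_nonneg _ _ ht]
  have hMs : ∀ y ∈ A, ∀ t : ℝ, 0 ≤ t → M (t • y) = t * M y := fun y hy t ht => by
    simp only [M, hαs y hy t ht, hβs y hy t ht, mul_max_of_nonneg _ _ ht]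
  have hpc := h.continuousOn_pos
  have hqc := h.continuousOn_neg
  have hJp : ContinuousOn (fun y => ‖J (p y)‖) A := (J.continuous.comp_continuousOn hpc).norm
  have hαc : ContinuousOn α A := (f.continuous.comp_continuousOn hpc).sub hJp
  have hβc : ContinuousOn β A :=
    ((f.continuous.comp_continuousOn hqc).neg.add J.continuous.norm.continuousOn).sub hJp
  have hMc : ContinuousOn M A := hαc.sup hβc
  have hGc : Continuous G := f.continuous.abs.max J.continuous.norm
  -- The homeomorphism is `Ψ ∘ R`: the radial map `R` turns the gauge `G` into `M`, and `Ψ` rescales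
  -- the two parts separately to the norms `α` and `β`.
  let R : V → V := fun y => (G y / M y) • y
  let Ψ : V → V := fun y => (α y / ‖p y‖) • p y + (β y / ‖q y‖) • q y
  have hRn : ∀ y ∈ A, 0 ≤ G y / M y := fun y hy => div_nonneg (hGn y) (hMn y hy)
  have hRA : ∀ y ∈ A, R y ∈ A := fun y hy => h.smul_mem hy (hRn y hy)
  have hMR : ∀ y ∈ A, M (R y) = G y := fun y hy => by
    simp only [R]
    rw [hMs y hy _ (hRn y hy)]
    by_cases h0 : M y = 0
    · have := hM0 y hy h0
      subst this
      simp [G]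
    · exact div_mul_cancel₀ _ h0
  have hRinj : Set.InjOn R A := by
    intro x hx y hy hxy
    have hGG : G x = G y := by rw [← hMR x hx, ← hMR y hy, hxy]
    by_cases hx0 : G x = 0
    · rw [hG0 x hx hx0, hG0 y hy (hGG ▸ hx0)]
    have hMx : M x ≠ 0 := fun h0 => hx0 (by rw [hM0 x hx h0]; simp [G])
    have hMy : M y ≠ 0 := fun h0 => hx0 (by rw [hGG, hM0 y hy h0]; simp [G])
    have e1 : G (R x) = G x / M x * G x := hGs x _ (hRn x hx)
    have e2 : G (R y) = G y / M y * G y := hGs y _ (hRn y hy)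
    rw [hxy, e2, hGG] at e1
    have e3 : G y / M y = G y / M x := mul_right_cancel₀ (hGG ▸ hx0) e1
    have e4 : (G y / M y) • x = (G y / M y) • y := by
      calc (G y / M y) • x = R x := by simp only [R, hGG, e3]
        _ = R y := hxy
    exact smul_right_injective V (div_ne_zero (hGG ▸ hx0) hMy) e4
  have hΨA : ∀ y ∈ A, Ψ y ∈ A := fun y hy => h.comb_mem y hy _ _
    (div_nonneg (hαn y hy) (norm_nonneg _)) (div_nonneg (hβn y hy) (norm_nonneg _))
  have hpΨ : ∀ y ∈ A, p (Ψ y) = (α y / ‖p y‖) • p y := fun y hy => h.pos_comb y hy _ _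
    (div_nonneg (hαn y hy) (norm_nonneg _)) (div_nonneg (hβn y hy) (norm_nonneg _))
  have hqΨ : ∀ y ∈ A, q (Ψ y) = (β y / ‖q y‖) • q y := fun y hy => h.neg_comb y hy _ _
    (div_nonneg (hαn y hy) (norm_nonneg _)) (div_nonneg (hβn y hy) (norm_nonneg _))
  have hpΨn : ∀ y ∈ A, ‖p (Ψ y)‖ = α y := fun y hy => by
    rw [hpΨ y hy, norm_smul, norm_div, norm_norm, Real.norm_of_nonneg (hαn y hy)]
    by_cases h0 : p y = 0
    · simp [h0, hα0 y hy h0]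
    · exact div_mul_cancel₀ _ (norm_ne_zero_iff.2 h0)
  have hqΨn : ∀ y ∈ A, ‖q (Ψ y)‖ = β y := fun y hy => by
    rw [hqΨ y hy, norm_smul, norm_div, norm_norm, Real.norm_of_nonneg (hβn y hy)]
    by_cases h0 : q y = 0
    · simp [h0, hβ0 y hy h0]
    · exact div_mul_cancel₀ _ (norm_ne_zero_iff.2 h0)
  -- the dependence of `β` on the negative part
  have hβcomb : ∀ y ∈ A, ∀ s t : ℝ, 0 ≤ s → 0 ≤ t → β (s • p y + t • q y) =
      t * -f (q y) + ‖J (s • p y + t • q y)‖ - ‖J (s • p y)‖ := fun y hy s t hs ht => by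
    simp only [β, h.pos_comb y hy s t hs ht, h.neg_comb y hy s t hs ht]
    simp
  -- Raising the coefficient of `q y` by `ε` adds `ε * -f (q y)` and lowers the norm term by at most
  -- `ε * ‖J (q y)‖`, which is less.
  have hβmono : ∀ y ∈ A, q y ≠ 0 → ∀ s t u : ℝ, 0 ≤ s → 0 ≤ t → t < u →
      β (s • p y + t • q y) < β (s • p y + u • q y) := by
    intro y hy hq s t u hs ht htu
    rw [hβcomb y hy s t hs ht, hβcomb y hy s u hs (ht.trans htu.le)]
    have e : J (s • p y + t • q y) = J (s • p y + u • q y) - (u - t) • J (q y) := by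
      simp only [map_add, map_smul]
      module
    have h1 : ‖J (s • p y + t • q y)‖ ≤ ‖J (s • p y + u • q y)‖ + (u - t) * ‖J (q y)‖ := by
      rw [e]
      refine (norm_sub_le _ _).trans_eq ?_
      rw [norm_smul, Real.norm_of_nonneg (sub_pos.2 htu).le]
    have h2 := mul_lt_mul_of_pos_left (hneg y hy hq) (sub_pos.2 htu)
    linarith
  have hΨinj : Set.InjOn Ψ A := by
    intro x hx y hy hxy
    have e1 : α x = α y := by rw [← hpΨn x hx, ← hpΨn y hy, hxy]
    have e2 : β x = β y := by rw [← hqΨn x hx, ← hqΨn y hy, hxy]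
    -- The positive parts lie on one ray, where the homogeneous function `α` fixes the scale; with
    -- `p` known, monotonicity of `β` then fixes `q`.
    have hp : p x = p y := by
      by_cases h0 : p x = 0
      · have : p y = 0 := by
          by_contra h1
          exact (hαp y hy h1).ne' (e1 ▸ hα0 x hx h0)
        rw [h0, this]
      have h1 : p y ≠ 0 := fun h1 => (hαp x hx h0).ne' (e1 ▸ hα0 y hy h1)
      have e3 : (α x / ‖p x‖) • p x = (α y / ‖p y‖) • p y := by
        rw [← hpΨ x hx, ← hpΨ y hy, hxy]
      have e4 : p x = (‖p x‖ / ‖p y‖) • p y := by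
        have := congrArg (fun z => (‖p x‖ / α x) • z) e3
        simp only [smul_smul] at this
        have ha := (hαp x hx h0).ne'
        have hn := norm_ne_zero_iff.2 h0
        rw [← e1, show ‖p x‖ / α x * (α x / ‖p x‖) = 1 by field_simp, one_smul] at this
        exact this.trans (by congr 1; field_simp)
      have hs : 0 ≤ ‖p x‖ / ‖p y‖ := by positivity
      have e5 : α x = ‖p x‖ / ‖p y‖ * α y := by
        simp only [α]
        rw [e4, map_smul, map_smul, norm_smul, Real.norm_of_nonneg hs, smul_eq_mul, ← e4]
        ring
      rw [e1] at e5
      have e6 : ‖p x‖ / ‖p y‖ = 1 := by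
        have := (hαp y hy h1).ne'
        exact (mul_right_cancel₀ this (by rw [one_mul]; exact e5)).symm
      rw [e4, e6, one_smul]
    have hq : q x = q y := by
      by_cases h0 : q x = 0
      · have : q y = 0 := by
          by_contra h1
          exact (hβp y hy h1).ne' (e2 ▸ hβ0 x hx h0)
        rw [h0, this]
      have h1 : q y ≠ 0 := fun h1 => (hβp x hx h0).ne' (e2 ▸ hβ0 y hy h1)
      have e3 : (β x / ‖q x‖) • q x = (β y / ‖q y‖) • q y := by
        rw [← hqΨ x hx, ← hqΨ y hy, hxy]
      have e4 : q x = (‖q x‖ / ‖q y‖) • q y := by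
        have := congrArg (fun z => (‖q x‖ / β x) • z) e3
        simp only [smul_smul] at this
        have ha := (hβp x hx h0).ne'
        have hn := norm_ne_zero_iff.2 h0
        rw [← e2, show ‖q x‖ / β x * (β x / ‖q x‖) = 1 by field_simp, one_smul] at this
        exact this.trans (by congr 1; field_simp)
      have hs : 0 ≤ ‖q x‖ / ‖q y‖ := by positivity
      have ex : x = (1 : ℝ) • p y + (‖q x‖ / ‖q y‖) • q y := by
        rw [one_smul, ← e4, ← hp, h.add_eq x hx]
      have ey : y = (1 : ℝ) • p y + (1 : ℝ) • q y := by
        rw [one_smul, one_smul, h.add_eq y hy]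
      rcases lt_trichotomy (‖q x‖ / ‖q y‖) 1 with hlt | heq | hgt
      · have := hβmono y hy h1 1 _ 1 zero_le_one hs hlt
        rw [← ex, ← ey] at this
        linarith
      · rw [e4, heq, one_smul]
      · have := hβmono y hy h1 1 1 _ zero_le_one zero_le_one hgt
        rw [← ex, ← ey] at this
        linarith
    rw [← h.add_eq x hx, ← h.add_eq y hy, hp, hq]
  have hΨsurj : ∀ z ∈ A, ∃ y ∈ A, Ψ y = z := by
    intro z hz
    -- `α` sees only the positive part, so `s` is found first by homogeneity. Then `t` comes from
    -- the intermediate value theorem, since `β` vanishes at `t = 0` and is at least `t * d`.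
    obtain ⟨s, hs, hs'⟩ : ∃ s : ℝ, 0 ≤ s ∧ s * α z = ‖p z‖ := by
      by_cases h0 : p z = 0
      · exact ⟨0, le_rfl, by simp [h0]⟩
      · exact ⟨‖p z‖ / α z, div_nonneg (norm_nonneg _) (hαn z hz),
          div_mul_cancel₀ _ (hαp z hz h0).ne'⟩
    obtain ⟨t, ht, ht'⟩ : ∃ t : ℝ, 0 ≤ t ∧ β (s • p z + t • q z) = ‖q z‖ := by
      by_cases h0 : q z = 0
      · refine ⟨0, le_rfl, ?_⟩
        rw [hβcomb z hz s 0 hs le_rfl]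
        simp [h0]
      have hd := sub_pos.2 (hneg z hz h0)
      set d := -f (q z) - ‖J (q z)‖
      let g : ℝ → ℝ := fun t => t * -f (q z) + ‖J (s • p z + t • q z)‖ - ‖J (s • p z)‖
      have hg : Continuous g := by fun_prop
      have hT : 0 ≤ ‖q z‖ / d := by positivity
      have hivt := intermediate_value_Icc hT hg.continuousOn
      have hmem : ‖q z‖ ∈ Set.Icc (g 0) (g (‖q z‖ / d)) := by
        constructor
        · simp [g]
        · have e : J (s • p z) = J (s • p z + (‖q z‖ / d) • q z) - (‖q z‖ / d) • J (q z) := by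
            simp only [map_add, map_smul]
            module
          have h1 : ‖J (s • p z)‖ ≤
              ‖J (s • p z + (‖q z‖ / d) • q z)‖ + ‖q z‖ / d * ‖J (q z)‖ := by
            nth_rw 1 [e]
            refine (norm_sub_le _ _).trans_eq ?_
            rw [norm_smul, Real.norm_of_nonneg hT]
          have h2 : ‖q z‖ / d * d = ‖q z‖ := div_mul_cancel₀ _ hd.ne'
          simp only [g]
          simp only [d] at h2 h1 ⊢
          linarith
      obtain ⟨t, ht, hgt⟩ := hivt hmem
      exact ⟨t, ht.1, by rw [hβcomb z hz s t hs ht.1]; exact hgt⟩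
    have hy := h.comb_mem z hz s t hs ht
    have hp := h.pos_comb z hz s t hs ht
    have hq := h.neg_comb z hz s t hs ht
    refine ⟨_, hy, ?_⟩
    have hα' : α (s • p z + t • q z) = ‖p z‖ := by
      rw [← hs']
      simp only [α, hp, map_smul, norm_smul, Real.norm_of_nonneg hs, smul_eq_mul]
      ring
    rw [← h.add_eq _ (hΨA _ hy), hpΨ _ hy, hqΨ _ hy, hα', ht', hp, hq]
    conv_rhs => rw [← h.add_eq z hz]
    congr 1
    · by_cases h0 : p z = 0
      · simp [h0]
      · have : s ≠ 0 := by
          rintro rfl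
          rw [zero_mul] at hs'
          exact h0 (norm_eq_zero.1 hs'.symm)
        have hn := norm_ne_zero_iff.2 h0
        rw [norm_smul, Real.norm_of_nonneg hs, smul_smul,
          show ‖p z‖ / (s * ‖p z‖) * s = 1 by field_simp, one_smul]
    · by_cases h0 : q z = 0
      · simp [h0]
      · have : t ≠ 0 := by
          rintro rfl
          rw [hβcomb z hz s 0 hs le_rfl] at ht'
          simp only [zero_mul, zero_smul, add_zero, zero_add, sub_self] at ht'
          exact h0 (norm_eq_zero.1 ht'.symm)
        have hn := norm_ne_zero_iff.2 h0
        rw [norm_smul, Real.norm_of_nonneg ht, smul_smul,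
          show ‖q z‖ / (t * ‖q z‖) * t = 1 by field_simp, one_smul]
  -- the continuity of the composite map
  have hfrac : ∀ γ : V → ℝ, ContinuousOn γ A → (∀ y ∈ A, 0 ≤ γ y) → (∀ y ∈ A, γ y ≤ M y) →
      ContinuousOn (fun y => G y / M y * γ y) A := by
    intro γ hγ hγn hγM x hx
    -- `M` vanishes only at `0`. There the product is squeezed by `G`, because `γ ≤ M`.
    by_cases h0 : M x = 0
    · have hx0 : G x = 0 := by rw [hM0 x hx h0]; simp [G]
      have hlim : Filter.Tendsto G (nhdsWithin x A) (nhds 0) := hx0 ▸ hGc.continuousWithinAt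
      rw [ContinuousWithinAt, hx0, zero_div, zero_mul]
      refine squeeze_zero' (Filter.eventually_of_mem self_mem_nhdsWithin fun y hy =>
        mul_nonneg (hRn y hy) (hγn y hy))
        (Filter.eventually_of_mem self_mem_nhdsWithin fun y hy => ?_) hlim
      rw [div_mul_eq_mul_div]
      exact div_le_of_le_mul₀ (hMn y hy) (hGn y)
        (mul_le_mul_of_nonneg_left (hγM y hy) (hGn y))
    · exact (hGc.continuousWithinAt.div (hMc x hx) h0).mul (hγ x hx)
  have hΦ : ∀ y ∈ A, Ψ (R y) = (G y / M y * α y / ‖p y‖) • p y +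
      (G y / M y * β y / ‖q y‖) • q y := by
    intro y hy
    by_cases h0 : G y / M y = 0
    · have hα00 : α 0 = 0 := by simpa using hαs y hy 0 le_rfl
      have hβ00 : β 0 = 0 := by simpa using hβs y hy 0 le_rfl
      simp [Ψ, R, h0, hα00, hβ00]
    have hn := hRn y hy
    simp only [Ψ, R]
    rw [hαs y hy _ hn, hβs y hy _ hn, h.pos_smul hy hn, h.neg_smul hy hn, norm_smul, norm_smul,
      Real.norm_of_nonneg hn, smul_smul, smul_smul]
    congr 2
    · rw [mul_div_mul_left _ _ h0]; ring
    · rw [mul_div_mul_left _ _ h0]; ring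
  have hΦc : ContinuousOn (fun y => Ψ (R y)) A := by
    refine ContinuousOn.congr ?_ hΦ
    exact (continuousOn_rescale (hfrac α hαc hαn fun y _ => le_max_left _ _) hpc
      fun y hy h0 => by rw [hα0 y hy h0, mul_zero]).add
      (continuousOn_rescale (hfrac β hβc hβn fun y _ => le_max_right _ _) hqc
      fun y hy h0 => by rw [hβ0 y hy h0, mul_zero])
  have hspace : ∀ y, ‖J y‖ ≤ 1 ∧ |f y| ≤ 1 ↔ G y ≤ 1 := fun y => by
    rw [max_le_iff, and_comm]
  have hcompact : IsCompact {v | v ∈ A ∧ ‖J v‖ ≤ 1 ∧ |f v| ≤ 1} := by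
    refine Metric.isCompact_of_isClosed_isBounded ?_ ?_
    · exact hA.inter ((isClosed_le J.continuous.norm continuous_const).inter
        (isClosed_le f.continuous.abs continuous_const))
    · refine (Metric.isBounded_closedBall (x := (0 : V)) (r := 1 / c)).subset fun v hv => ?_
      rw [mem_closedBall_zero_iff, le_div_iff₀ hc]
      linarith [hJ v hv.1, hv.2.1]
  refine SpacePair.IsHomeomorphic.of_bijOn hcompact (φ := fun y => Ψ (R y))
    (hΦc.mono fun v hv => hv.1) ⟨?_, ?_, ?_⟩ ?_
  · rintro v ⟨hv, hv'⟩
    have h1 : M (R v) ≤ 1 := (hMR v hv).trans_le ((hspace v).1 hv')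
    have hR := hRA v hv
    exact ⟨hΨA _ hR, (hpΨn _ hR).trans_le ((le_max_left _ _).trans h1),
      (hqΨn _ hR).trans_le ((le_max_right _ _).trans h1)⟩
  · intro x hx y hy hxy
    exact hRinj hx.1 hy.1 (hΨinj (hRA x hx.1) (hRA y hy.1) hxy)
  · rintro z ⟨hz, hz1, hz2⟩
    obtain ⟨y, hy, rfl⟩ := hΨsurj z hz
    rw [hpΨn y hy] at hz1
    rw [hqΨn y hy] at hz2
    have hn : 0 ≤ M y / G y := div_nonneg (hMn y hy) (hGn y)
    have hx := h.smul_mem hy hn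
    have hRx : R ((M y / G y) • y) = y := by
      by_cases h0 : y = 0
      · simp [R, h0]
      have hG : G y ≠ 0 := fun h1 => h0 (hG0 y hy h1)
      have hM : M y ≠ 0 := fun h1 => h0 (hM0 y hy h1)
      simp only [R]
      rw [hGs y _ hn, hMs y hy _ hn, smul_smul]
      convert one_smul ℝ y
      field_simp
    refine ⟨(M y / G y) • y, ⟨hx, (hspace _).2 ?_⟩, by simp only [hRx]⟩
    rw [← hMR _ hx, hRx]
    exact max_le hz1 hz2
  -- Both memberships amount to `G v = 1` and `β v ≤ α v`, the latter being `‖J v‖ ≤ f v`.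
  · rintro v ⟨hv, hv'⟩
    have hR := hRA v hv
    have hG1 := (hspace v).1 hv'
    have hp1 : ‖p (Ψ (R v))‖ = G v / M v * α v := by
      rw [hpΨn _ hR]; exact hαs v hv _ (hRn v hv)
    have hq1 : ‖q (Ψ (R v))‖ ≤ 1 :=
      (hqΨn _ hR).trans_le ((le_max_right _ _).trans ((hMR v hv).trans_le hG1))
    have hab := hαβ v hv
    change (v ∈ A ∧ ‖J v‖ ≤ 1 ∧ f v = 1) ↔ (_ ∧ _ ∧ _)
    constructor
    · rintro ⟨-, hJ1, hf1⟩
      refine ⟨hΨA _ hR, ?_, hq1⟩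
      have hM : M v = α v := max_eq_left (by linarith)
      have hGv : G v = 1 := le_antisymm hG1 ((le_abs_self _).trans' hf1.ge |>.trans (le_max_left _ _))
      have hM0' : M v ≠ 0 := fun h0 => by
        rw [hM0 v hv h0] at hf1
        simp at hf1
      rw [hp1, ← hM, hGv]
      field_simp
    · rintro ⟨-, hpp, -⟩
      rw [hp1] at hpp
      have hM0' : M v ≠ 0 := fun h0 => by rw [h0] at hpp; simp at hpp
      have hMpos := (hMn v hv).lt_of_ne' hM0'
      have e1 : G v * α v = M v := by
        field_simp at hpp
        linarith
      have h1 : α v ≤ M v := le_max_left _ _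
      have hGv : G v = 1 := by
        refine le_antisymm hG1 ?_
        by_contra! hlt
        nlinarith [hαn v hv, hGn v]
      have hM : β v ≤ α v := by
        rw [hGv, one_mul] at e1
        rw [e1]
        exact le_max_right _ _
      have hfn : ‖J v‖ ≤ f v := by linarith
      refine ⟨hv, hv'.1, ?_⟩
      have : G v = f v := by
        simp only [G]
        rw [abs_of_nonneg ((norm_nonneg _).trans hfn), max_eq_left hfn]
      rw [← this, hGv]

end Model

end SignSplitting

/-! ### Products of splittings and independence of the parameters -/

theorem splitPair_prod {V V' : Type*} [NormedAddCommGroup V] [NormedAddCommGroup V'] (A : Set V) (p q : V → V)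
    (A' : Set V') (p' q' : V' → V') :
    splitPair (A ×ˢ A') (Prod.map p p') (Prod.map q q') =
      (splitPair A p q).prod (splitPair A' p' q') := by
  simp only [splitPair, SpacePair.prod, SpacePair.mk.injEq]
  constructor
  · ext ⟨y, y'⟩
    simp only [Set.mem_prod, Prod.map_apply, Prod.norm_mk, max_le_iff, Set.mem_ofPred_eq]
    tauto
  · ext ⟨y, y'⟩
    have h1 : max ‖p y‖ ‖p' y'‖ = 1 ↔
        ‖p y‖ = 1 ∧ ‖p' y'‖ ≤ 1 ∨ ‖p y‖ ≤ 1 ∧ ‖p' y'‖ = 1 := by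
      rw [max_eq_iff]
      constructor
      · rintro (⟨h1, h2⟩ | ⟨h1, h2⟩)
        · exact .inl ⟨h1, h1 ▸ h2⟩
        · exact .inr ⟨h1 ▸ h2, h1⟩
      · rintro (⟨h1, h2⟩ | ⟨h1, h2⟩)
        · exact .inl ⟨h1, h1 ▸ h2⟩
        · exact .inr ⟨h2, h2 ▸ h1⟩
    simp only [Set.mem_prod, Set.mem_union, Prod.map_apply, Prod.norm_mk, max_le_iff,
      Set.mem_ofPred_eq, h1]
    tauto

namespace SignSplitting

variable {V : Type*} [NormedAddCommGroup V] [NormedSpace ℝ V]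
  {A : Set V} {f g : V →L[ℝ] ℝ} {p q : V → V}

theorem of_sign (h : SignSplitting A f p q) (h1 : ∀ y ∈ A, 0 < f y → 0 < g y)
    (h2 : ∀ y ∈ A, f y < 0 → g y < 0) : SignSplitting A g p q where
  __ := h
  pos y hy hne := h1 _ (h.pos_mem hy) (h.pos y hy hne)
  neg y hy hne := h2 _ (h.swap.pos_mem hy) (h.neg y hy hne)

theorem prod {V' : Type*} [NormedAddCommGroup V'] [NormedSpace ℝ V'] {A' : Set V'}
    {f' : V' →L[ℝ] ℝ} {p' q' : V' → V'} (h : SignSplitting A f p q)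
    (h' : SignSplitting A' f' p' q') :
    SignSplitting (A ×ˢ A') (f.coprod f') (Prod.map p p') (Prod.map q q') where
  continuousOn_pos := h.continuousOn_pos.prodMap h'.continuousOn_pos
  continuousOn_neg := h.continuousOn_neg.prodMap h'.continuousOn_neg
  add_eq y hy := Prod.ext (h.add_eq _ hy.1) (h'.add_eq _ hy.2)
  comb_mem y hy s t hs ht := ⟨h.comb_mem _ hy.1 s t hs ht, h'.comb_mem _ hy.2 s t hs ht⟩
  pos_comb y hy s t hs ht := Prod.ext (h.pos_comb _ hy.1 s t hs ht) (h'.pos_comb _ hy.2 s t hs ht)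
  neg_comb y hy s t hs ht := Prod.ext (h.neg_comb _ hy.1 s t hs ht) (h'.neg_comb _ hy.2 s t hs ht)
  pos := by
    rintro ⟨y, y'⟩ ⟨hy, hy'⟩ hne
    have h1 := h.pos y hy
    have h2 := h'.pos y' hy'
    simp only [Prod.map_apply, ContinuousLinearMap.coprod_apply]
    simp only [Prod.map_apply, ne_eq, Prod.mk_eq_zero, not_and_or] at hne
    by_cases h3 : p y = 0
    · simpa [h3] using h2 (hne.resolve_left (not_not.2 h3))
    by_cases h4 : p' y' = 0
    · simpa [h4] using h1 h3
    · exact add_pos (h1 h3) (h2 h4)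
  neg := by
    rintro ⟨y, y'⟩ ⟨hy, hy'⟩ hne
    have h1 := h.neg y hy
    have h2 := h'.neg y' hy'
    simp only [Prod.map_apply, ContinuousLinearMap.coprod_apply]
    simp only [Prod.map_apply, ne_eq, Prod.mk_eq_zero, not_and_or] at hne
    by_cases h3 : q y = 0
    · simpa [h3] using h2 (hne.resolve_left (not_not.2 h3))
    by_cases h4 : q' y' = 0
    · simpa [h4] using h1 h3
    · exact add_neg (h1 h3) (h2 h4)

variable {W : Type*} [NormedAddCommGroup W] [InnerProductSpace ℝ W]

/-- The cone / link pair of a set that near `0` is the injective linear image of a cone with a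
splitting does not depend on the small parameters. -/
theorem exists_coneLink_isHomeomorphic [FiniteDimensional ℝ V] (h : SignSplitting A f p q)
    (hA : IsClosed A) (j : V →L[ℝ] W) (a : W) (hf : ∀ v ∈ A, f v = ⟪j v, a⟫)
    {c : ℝ} (hc : 0 < c) (hj : ∀ x ∈ A, ∀ y ∈ A, c * ‖x - y‖ ≤ ‖j x - j y‖) :
    ∃ κ > 0, ∀ (X : Set W) (r δ : ℝ), 0 < r → 0 < δ → δ ≤ κ * r →
      (∀ y, ‖y‖ ≤ r → (y ∈ X ↔ ∃ v ∈ A, j v = y)) →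
      (coneLink X 0 a r δ).IsHomeomorphic (splitPair A p q) := by
  obtain ⟨m, hm, hm'⟩ := h.exists_le_pos hA
  obtain ⟨m', hm0, hmq⟩ := h.swap.exists_le_pos hA
  have hB : 0 < ‖j‖ + 1 := by positivity
  -- With this bound on `δ / r`, the linear growth of `f` on both parts beats `‖j v‖`: a nonzero
  -- pure part leaves the slab strictly before the ball. The `+ 1` gives strictness and covers `j =
  -- 0`.
  refine ⟨min m m' / (‖j‖ + 1), by positivity, fun X r δ hr hδ hδr hX => ?_⟩
  have hδm : δ * (‖j‖ + 1) ≤ min m m' * r := by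
    rwa [div_mul_eq_mul_div, le_div_iff₀ hB] at hδr
  have aux : ∀ (v : V) (μ x : ℝ), min m m' ≤ μ → v ≠ 0 → μ * ‖v‖ ≤ x →
      ‖(r⁻¹ • j) v‖ < δ⁻¹ * x := by
    intro v μ x hμ hv hx
    have hv' := norm_pos_iff.2 hv
    rw [smul_apply, norm_smul, norm_inv, Real.norm_of_nonneg hr.le,
      inv_mul_eq_div, inv_mul_eq_div, div_lt_div_iff₀ hr hδ]
    calc ‖j v‖ * δ ≤ ‖j‖ * ‖v‖ * δ := by gcongr; exact j.le_opNorm v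
      _ < (‖j‖ + 1) * ‖v‖ * δ := by gcongr; linarith
      _ = δ * (‖j‖ + 1) * ‖v‖ := by ring
      _ ≤ min m m' * r * ‖v‖ := by gcongr
      _ ≤ μ * r * ‖v‖ := by gcongr
      _ = μ * ‖v‖ * r := by ring
      _ ≤ x * r := by gcongr
  have hδ' := inv_pos.2 hδ
  have hs : SignSplitting A (δ⁻¹ • f) p q := h.of_sign
    (fun y _ hy => mul_pos hδ' hy) (fun y _ hy => mul_neg_of_pos_of_neg hδ' hy)
  have hj0 : ∀ y ∈ A, c * ‖y‖ ≤ ‖j y‖ := fun y hy => by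
    simpa using hj y hy 0 (by simpa using h.smul_mem hy le_rfl)
  have h1 := hs.isHomeomorphic_splitPair hA (r⁻¹ • j) (c := r⁻¹ * c) (by positivity)
    (fun y hy => by
      rw [smul_apply, norm_smul, norm_inv, Real.norm_of_nonneg hr.le, mul_assoc]
      exact mul_le_mul_of_nonneg_left (hj0 y hy) (inv_pos.2 hr).le)
    (fun y hy hne => aux _ m _ (min_le_left _ _) hne (hm' y hy))
    (fun y hy hne => by
      have := aux _ m' _ (min_le_right _ _) hne (hmq y hy)
      simpa using this)
  refine SpacePair.IsHomeomorphic.trans (SpacePair.IsHomeomorphic.symm ?_) h1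
  have e1 : ∀ v, ‖(r⁻¹ • j) v‖ ≤ 1 ↔ ‖j v‖ ≤ r := fun v => by
    rw [smul_apply, norm_smul, norm_inv, Real.norm_of_nonneg hr.le,
      inv_mul_eq_div, div_le_one hr]
  have e2 : ∀ v ∈ A, |(δ⁻¹ • f) v| ≤ 1 ↔ -δ ≤ ⟪j v, a⟫ ∧ ⟪j v, a⟫ ≤ δ := fun v hv => by
    rw [smul_apply, smul_eq_mul, abs_mul, abs_of_pos hδ', inv_mul_eq_div,
      div_le_one hδ, abs_le, hf v hv]
  have e3 : ∀ v ∈ A, (δ⁻¹ • f) v = 1 ↔ ⟪j v, a⟫ = δ := fun v hv => by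
    rw [smul_apply, smul_eq_mul, inv_mul_eq_one₀ hδ.ne', hf v hv, eq_comm]
  have hcompact : IsCompact {v | v ∈ A ∧ ‖(r⁻¹ • j) v‖ ≤ 1 ∧ |(δ⁻¹ • f) v| ≤ 1} := by
    refine Metric.isCompact_of_isClosed_isBounded ?_ ?_
    · exact hA.inter ((isClosed_le (r⁻¹ • j).continuous.norm continuous_const).inter
        (isClosed_le (δ⁻¹ • f).continuous.abs continuous_const))
    · refine (Metric.isBounded_closedBall (x := (0 : V)) (r := r / c)).subset fun v hv => ?_
      rw [mem_closedBall_zero_iff, le_div_iff₀ hc]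
      linarith [hj0 v hv.1, (e1 v).1 hv.2.1]
  refine SpacePair.IsHomeomorphic.of_bijOn hcompact (φ := j) j.continuous.continuousOn
    ⟨?_, ?_, ?_⟩ ?_
  · rintro v ⟨hv, hv1, hv2⟩
    rw [e1] at hv1
    rw [e2 v hv] at hv2
    simp only [coneLink, sub_zero]
    exact ⟨⟨(hX _ hv1).2 ⟨v, hv, rfl⟩, mem_closedBall_zero_iff.2 hv1⟩, hv2⟩
  · intro x hx y hy hxy
    have := hj x hx.1 y hy.1
    rw [hxy, sub_self, norm_zero] at this
    exact sub_eq_zero.1 (norm_le_zero_iff.1 (by by_contra! h3; nlinarith))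
  · rintro y ⟨⟨hyX, hyr⟩, hy⟩
    rw [mem_closedBall_zero_iff] at hyr
    rw [sub_zero] at hy
    obtain ⟨v, hv, rfl⟩ := (hX y hyr).1 hyX
    exact ⟨v, ⟨hv, (e1 v).2 hyr, (e2 v hv).2 hy⟩, rfl⟩
  · rintro v ⟨hv, hv1, hv2⟩
    have hv1' := (e1 v).1 hv1
    simp only [coneLink, sub_zero, Set.mem_ofPred_eq, hv, hv1, e3 v hv, true_and, Set.mem_inter_iff,
      mem_closedBall_zero_iff, hv1', and_true, (hX _ hv1').2 ⟨v, hv, rfl⟩]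

end SignSplitting

/-! ### Tangent cones and the local structure of complexes at `0` -/

section LocalStructure

variable {E : Type*} [NormedAddCommGroup E] [InnerProductSpace ℝ E]

/-- The cone of all directions in which `P` extends from `0`. -/
def coneAt (P : Set E) : Set E := {y | ∃ t : ℝ, 0 < t ∧ t • y ∈ P}

theorem subset_coneAt (P : Set E) : P ⊆ coneAt P := fun y hy => ⟨1, one_pos, by simpa using hy⟩

theorem tendsto_smul_zero (y : E) : Tendsto (fun s : ℝ => s • y) (𝓝[>] 0) (𝓝 0) := by
  have : Tendsto (fun s : ℝ => s • y) (𝓝 0) (𝓝 ((0 : ℝ) • y)) :=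
    (continuous_id.smul continuous_const).tendsto 0
  rw [zero_smul] at this
  exact this.mono_left nhdsWithin_le_nhds

theorem eventually_smul_mem {P : Set E} (hP : Convex ℝ P) (h0 : (0 : E) ∈ P) {y : E}
    (hy : y ∈ coneAt P) : ∀ᶠ s : ℝ in 𝓝[>] 0, s • y ∈ P := by
  obtain ⟨t, ht, hty⟩ := hy
  filter_upwards [Ioc_mem_nhdsGT ht] with s hs
  have := hP.smul_mem_of_zero_mem h0 hty (t := s / t)
    ⟨div_nonneg hs.1.le ht.le, (div_le_one ht).2 hs.2⟩
  rwa [smul_smul, div_mul_cancel₀ _ ht.ne'] at this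

/-- Only the inequalities that are equalities at `0` cut out the tangent cone; the others hold
automatically near `0`. -/
theorem IsPolytope.isPolyhedralCone_coneAt {P : Set E} (hP : IsPolytope P) (h0 : (0 : E) ∈ P) :
    IsPolyhedralCone (coneAt P) ∧ ∀ᶠ y in 𝓝 (0 : E), y ∈ coneAt P → y ∈ P := by
  classical
  obtain ⟨-, H, rfl⟩ := hP
  have hn : ∀ h ∈ H, 0 ≤ h.2 := fun h hh => by simpa using h0 h hh
  have hev : ∀ᶠ y in 𝓝 (0 : E), ∀ h ∈ H, 0 < h.2 → ⟪h.1, y⟫ ≤ h.2 := by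
    rw [eventually_all_finset]
    intro h hh
    by_cases hpos : 0 < h.2
    · have hc : Continuous fun y : E => ⟪h.1, y⟫ := by fun_prop
      have := hc.tendsto 0
      rw [inner_zero_right] at this
      filter_upwards [this.eventually_lt_const hpos] with y hy _ using hy.le
    · exact Eventually.of_forall fun y hy => absurd hy hpos
  have key : ∀ y ∈ coneAt {y | ∀ h ∈ H, ⟪h.1, y⟫ ≤ h.2}, ∀ h ∈ H, h.2 = 0 → ⟪h.1, y⟫ ≤ 0 := by
    rintro y ⟨t, ht, hty⟩ h hh heq
    have := hty h hh
    rw [real_inner_smul_right, heq] at this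
    by_contra! hcon
    exact (mul_pos ht hcon).not_ge this
  constructor
  · refine ⟨(H.filter fun h => h.2 = 0).image Prod.fst, ?_⟩
    ext y
    constructor
    · intro hy h hh
      obtain ⟨g, hg, rfl⟩ := Finset.mem_image.1 hh
      obtain ⟨hgH, hg0⟩ := Finset.mem_filter.1 hg
      exact key y hy g hgH hg0
    · intro hy
      obtain ⟨s, hs, hs0⟩ := (((tendsto_smul_zero y).eventually hev).and
        self_mem_nhdsWithin).exists
      refine ⟨s, hs0, fun h hh => ?_⟩
      rcases (hn h hh).lt_or_eq with hpos | heq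
      · exact hs h hh hpos
      · rw [real_inner_smul_right, ← heq]
        exact mul_nonpos_of_nonneg_of_nonpos (le_of_lt hs0)
          (hy h.1 (Finset.mem_image_of_mem _ (Finset.mem_filter.2 ⟨hh, heq.symm⟩)))
  · filter_upwards [hev] with y hy hc h hh
    rcases (hn h hh).lt_or_eq with hpos | heq
    · exact hy h hh hpos
    · exact (key y hc h hh heq.symm).trans heq.le

theorem IsPolytope.isClosed {P : Set E} (hP : IsPolytope P) : IsClosed P := by
  obtain ⟨-, H, rfl⟩ := hP
  have : {y : E | ∀ h ∈ H, ⟪h.1, y⟫ ≤ h.2} = ⋂ h ∈ H, {y | ⟪h.1, y⟫ ≤ h.2} := by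
    ext; simp
  rw [this]
  exact isClosed_biInter fun h _ => isClosed_le (by fun_prop) continuous_const

/-- The tangent cone of a minimal face. -/
theorem coneAt_minFace {P : Set E} (hP : IsPolytope P) (h0 : (0 : E) ∈ P) {x : E}
    (hx : x ∈ coneAt P) : ∃ x' ∈ P, (0 : E) ∈ minFace P x' ∧
      coneAt (minFace P x') = {y | y ∈ coneAt P ∧ ∃ η : ℝ, 0 < η ∧ x - η • y ∈ coneAt P} := by
  obtain ⟨hcone, hev⟩ := hP.isPolyhedralCone_coneAt h0
  -- `t` is so small that cone points near `2 t x` lie in `P`. Then `t x` is the midpoint of `0` and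
  -- a point of `P`, so its minimal face contains `0`.
  obtain ⟨t, ⟨ht1, ht2⟩, ht⟩ := (((tendsto_smul_zero x).eventually hev).and
    (((tendsto_smul_zero ((2 : ℝ) • x)).eventually hev.eventually_nhds)) |>.and
      self_mem_nhdsWithin).exists
  have ht : 0 < t := ht
  have hx' : t • x ∈ P := ht1 (hcone.smul_mem hx ht.le)
  have h2x : t • (2 : ℝ) • x ∈ coneAt P := hcone.smul_mem (hcone.smul_mem hx zero_le_two) ht.le
  refine ⟨t • x, hx', ⟨h0, 1, one_pos, ?_⟩, ?_⟩
  · convert ht2.self_of_nhds h2x using 1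
    module
  · ext y
    constructor
    · rintro ⟨s, hs, hy, ε, hε, hmem⟩
      refine ⟨⟨s, hs, hy⟩, ε * s / ((1 + ε) * t), by positivity, ?_⟩
      have := hcone.smul_mem (subset_coneAt P hmem) (t := ((1 + ε) * t)⁻¹) (by positivity)
      convert this using 1
      match_scalars <;> field_simp
    · rintro ⟨hy, η, hη, hmem⟩
      have e1 : Tendsto (fun s : ℝ => t • (2 : ℝ) • x - s • y) (𝓝[>] 0)
          (𝓝 (t • (2 : ℝ) • x)) := by
        simpa using tendsto_const_nhds.sub (tendsto_smul_zero y)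
      obtain ⟨s, ⟨⟨hs1, hs2⟩, hs3⟩, hs⟩ := ((((eventually_smul_mem hP.convex h0 hy).and
        (e1.eventually ht2)).and (Ioc_mem_nhdsGT (show 0 < 2 * t * η by positivity))).and
        self_mem_nhdsWithin).exists
      have hs : 0 < s := hs
      refine ⟨s, hs, hs1, 1, one_pos, ?_⟩
      have e2 : t • x + (1 : ℝ) • (t • x - s • y) = t • (2 : ℝ) • x - s • y := by module
      rw [e2]
      apply hs2
      have e3 : t • (2 : ℝ) • x - s • y =
          (2 * t - s / η) • x + (s / η) • (x - η • y) := by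
        match_scalars <;> field_simp
        ring
      rw [e3]
      have e4 : s / η ≤ 2 * t := (div_le_iff₀ hη).2 hs3.2
      exact hcone.add_mem (hcone.smul_mem hx (by linarith)) (hcone.smul_mem hmem (by positivity))

namespace PolyhedralComplex

/-- The tangent cones at `0` of the faces of the complex that contain `0` and lie in `B`. -/
def fanAt (K : PolyhedralComplex E) (B : Set E) : Set (Set E) :=
  coneAt '' {P | P ∈ K.faces ∧ (0 : E) ∈ P ∧ P ⊆ B}

theorem pointedFan_fanAt (K : PolyhedralComplex E) (B : Set E) (hK : {0} ∈ K.faces) :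
    PointedFan (K.fanAt B) where
  finite := (K.finite.subset fun P hP => hP.1).image _
  cone := by
    rintro _ ⟨P, ⟨hP, h0, -⟩, rfl⟩
    exact ((K.polytope P hP).isPolyhedralCone_coneAt h0).1
  pointed := by
    rintro _ ⟨P, ⟨hP, h0, -⟩, rfl⟩ y hy hy'
    have hconv := (K.polytope P hP).convex
    have hface := (K.inter_face P hP {0} hK ⟨0, h0, rfl⟩).2.2
    obtain ⟨s, ⟨hs1, hs2⟩, hs⟩ := (((eventually_smul_mem hconv h0 hy).and
      (eventually_smul_mem hconv h0 hy')).and self_mem_nhdsWithin).exists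
    have hs : 0 < s := hs
    -- `0` is the midpoint of `s • y` and `s • -y`, and `{0}` is extreme in `P`.
    have := hface.left_mem_of_mem_openSegment hs1 hs2 (z := 0) ⟨h0, rfl⟩
      ⟨1 / 2, 1 / 2, by norm_num, by norm_num, by norm_num, by module⟩
    exact (smul_eq_zero.1 this.2).resolve_left hs.ne'
  face := by
    rintro _ ⟨P, ⟨hP, h0, hPB⟩, rfl⟩ x hx
    obtain ⟨x', hx', h0', he⟩ := coneAt_minFace (K.polytope P hP) h0 hx
    exact ⟨minFace P x', ⟨K.face_mem P hP _ (isFaceOf_minFace (K.polytope P hP).convex hx'), h0',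
      fun y hy => hPB hy.1⟩, he⟩
  extreme := by
    rintro _ ⟨P, ⟨hP, h0, -⟩, rfl⟩ _ ⟨Q, ⟨hQ, h0', -⟩, rfl⟩ x hx y hy hxy
    have hconv := (K.polytope P hP).convex
    have hface := (K.inter_face P hP Q hQ ⟨0, h0, h0'⟩).2.2
    have hcone := ((K.polytope P hP).isPolyhedralCone_coneAt h0).1
    -- The factor `2` makes `s • (x + y)` the midpoint of two points of `P`.
    have h2 := fun z (hz : z ∈ coneAt P) =>
      eventually_smul_mem hconv h0 (hcone.smul_mem hz zero_le_two)
    obtain ⟨s, ⟨⟨⟨hs1, hs2⟩, hs3⟩, hs4⟩, hs⟩ := ((((h2 x hx).and (h2 y hy)).and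
      (eventually_smul_mem (K.polytope Q hQ).convex h0' hxy)).and
      (eventually_smul_mem hconv h0 (hcone.add_mem hx hy)) |>.and self_mem_nhdsWithin).exists
    have hs : 0 < s := hs
    have := hface.left_mem_of_mem_openSegment hs1 hs2 ⟨hs4, hs3⟩
      ⟨1 / 2, 1 / 2, by norm_num, by norm_num, by norm_num, by module⟩
    exact ⟨s * 2, by positivity, by rw [mul_smul]; exact this.2⟩

theorem eventually_mem_face (K : PolyhedralComplex E) :
    ∀ᶠ y in 𝓝 (0 : E), ∀ P ∈ K.faces, y ∈ P → (0 : E) ∈ P := by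
  rw [K.finite.eventually_all]
  intro P hP
  by_cases h0 : (0 : E) ∈ P
  · exact Eventually.of_forall fun _ _ => h0
  · filter_upwards [(K.polytope P hP).isClosed.isOpen_compl.mem_nhds h0] with y hy hy'
    exact absurd hy' hy

theorem eventually_mem_of_coneAt (K : PolyhedralComplex E) :
    ∀ᶠ y in 𝓝 (0 : E), ∀ P ∈ K.faces, (0 : E) ∈ P → y ∈ coneAt P → y ∈ P := by
  rw [K.finite.eventually_all]
  intro P hP
  by_cases h0 : (0 : E) ∈ P
  · filter_upwards [((K.polytope P hP).isPolyhedralCone_coneAt h0).2] with y hy _ using hy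
  · exact Eventually.of_forall fun _ h => absurd h h0

theorem IsGeneric.inter_comm [FiniteDimensional ℝ E] {K K' : PolyhedralComplex E} {x a : E}
    (h : (K.inter K').IsGeneric x a) : (K'.inter K).IsGeneric x a := by
  rintro F ⟨hF, P, hP, Q, hQ, rfl⟩
  exact h _ ⟨hF, Q, hQ, P, hP, Set.inter_comm _ _⟩

end PolyhedralComplex

/-- As `0 ∈ F`, the affine and the linear span of `F` coincide, and the relative interior is open in
it. -/
theorem eventually_mem_intrinsicInterior {F : Set E} (h0 : (0 : E) ∈ intrinsicInterior ℝ F) :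
    ∀ᶠ y in 𝓝 (0 : E), y ∈ Submodule.span ℝ F → y ∈ intrinsicInterior ℝ F := by
  have hF0 : (0 : E) ∈ F := intrinsicInterior_subset h0
  have hspan : (affineSpan ℝ F : Set E) = Submodule.span ℝ F := by
    rw [← affineSpan_insert_zero, Set.insert_eq_of_mem hF0]
  obtain ⟨z, hz, hz0⟩ := mem_intrinsicInterior.1 h0
  have hnhds := isOpen_interior.mem_nhds hz
  rw [nhds_subtype, hz0, mem_comap] at hnhds
  obtain ⟨U, hU, hUs⟩ := hnhds
  filter_upwards [hU] with y hy hys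
  have hy' : y ∈ affineSpan ℝ F := by
    rw [← SetLike.mem_coe, hspan]
    exact hys
  exact mem_intrinsicInterior.2 ⟨⟨y, hy'⟩, hUs hy, rfl⟩

theorem span_subset_coneAt {F : Set E} (h0 : (0 : E) ∈ intrinsicInterior ℝ F) :
    (Submodule.span ℝ F : Set E) ⊆ coneAt F := by
  intro y hy
  obtain ⟨s, hs, hs0⟩ := (((tendsto_smul_zero y).eventually
    (eventually_mem_intrinsicInterior h0)).and self_mem_nhdsWithin).exists
  exact ⟨s, hs0, intrinsicInterior_subset (hs (Submodule.smul_mem _ _ hy))⟩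

namespace PolyhedralComplex

variable {K K' : PolyhedralComplex E} {F : Set E}

/-- `F ∩ P` is extreme in `F` and contains a relative interior point of `F`, hence is all of `F`. -/
theorem subset_of_mem_intrinsicInterior (hF : F ∈ K.faces)
    (h0 : (0 : E) ∈ intrinsicInterior ℝ F) {P : Set E} (hP : P ∈ K.faces) (hP0 : (0 : E) ∈ P) :
    F ⊆ P := by
  intro y hy
  have hF0 := intrinsicInterior_subset h0
  obtain ⟨ε, hε, hmem⟩ := extend_mem h0 hy
  have hface := (K.inter_face F hF P hP ⟨0, hF0, hP0⟩).2.2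
  refine (hface.left_mem_of_mem_openSegment hy hmem (z := 0) ⟨hF0, hP0⟩
    ⟨ε / (1 + ε), 1 / (1 + ε), by positivity, by positivity, by field_simp; ring, ?_⟩).2
  match_scalars
  field_simp
  ring

/-- Near a relative interior point of the face `F`, the space is invariant under translations
along `F`. -/
theorem eventually_mem_space_iff (hF : F ∈ K.faces) (h0 : (0 : E) ∈ intrinsicInterior ℝ F)
    {π : E → E} (hπ : Continuous π) (hπ0 : π 0 = 0)
    (hsub : ∀ y, y - π y ∈ Submodule.span ℝ F) :
    ∀ᶠ y in 𝓝 (0 : E), y ∈ K.space ↔ π y ∈ K.space := by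
  have ht : Tendsto π (𝓝 0) (𝓝 0) := by simpa [hπ0] using hπ.tendsto 0
  -- The tangent cone of `P` contains that of `F`, which includes the whole span, and is closed
  -- under addition.
  have hcone : ∀ P ∈ K.faces, (0 : E) ∈ P → ∀ z ∈ P, ∀ u ∈ Submodule.span ℝ F,
      z + u ∈ coneAt P := by
    intro P hP hP0 z hz u hu
    refine ((K.polytope P hP).isPolyhedralCone_coneAt hP0).1.add_mem (subset_coneAt P hz) ?_
    obtain ⟨t, ht, htu⟩ := span_subset_coneAt h0 hu
    exact ⟨t, ht, subset_of_mem_intrinsicInterior hF h0 hP hP0 htu⟩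
  filter_upwards [K.eventually_mem_face, ht.eventually K.eventually_mem_face,
    K.eventually_mem_of_coneAt, ht.eventually K.eventually_mem_of_coneAt] with y h1 h2 h3 h4
  constructor
  · rintro ⟨P, hP, hy⟩
    have hP0 := h1 P hP hy
    refine ⟨P, hP, h4 P hP hP0 ?_⟩
    have := hcone P hP hP0 y hy _ (neg_mem (hsub y))
    rwa [neg_sub, add_sub_cancel] at this
  · rintro ⟨P, hP, hy⟩
    have hP0 := h2 P hP hy
    refine ⟨P, hP, h3 P hP hP0 ?_⟩
    have := hcone P hP hP0 _ hy _ (hsub y)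
    rwa [add_sub_cancel] at this

/-- Near `0`, the slice of one complex by the span of a face of the other is a fan. -/
theorem eventually_mem_slice_iff [FiniteDimensional ℝ E] (hF : F ∈ K.faces)
    (h0 : (0 : E) ∈ intrinsicInterior ℝ F) :
    ∀ᶠ y in 𝓝 (0 : E), y ∈ K'.space ∩ (Submodule.span ℝ F : Set E) ↔
      y ∈ ⋃₀ (K.inter K').fanAt F := by
  filter_upwards [eventually_mem_intrinsicInterior h0, K'.eventually_mem_face,
    (K.inter K').eventually_mem_of_coneAt] with y h1 h2 h3
  constructor
  -- Near `0` the span of `F` is `F` itself, so the slice consists of the faces `F ∩ Q`.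
  · rintro ⟨⟨Q, hQ, hyQ⟩, hys⟩
    have hyF := intrinsicInterior_subset (h1 hys)
    exact ⟨_, ⟨F ∩ Q, ⟨⟨⟨y, hyF, hyQ⟩, F, hF, Q, hQ, rfl⟩,
      ⟨intrinsicInterior_subset h0, h2 Q hQ hyQ⟩, Set.inter_subset_left⟩, rfl⟩,
      subset_coneAt _ ⟨hyF, hyQ⟩⟩
  · rintro ⟨_, ⟨P, ⟨hP, hP0, hPF⟩, rfl⟩, hy⟩
    have hyP := h3 P hP hP0 hy
    refine ⟨?_, Submodule.subset_span (hPF hyP)⟩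
    obtain ⟨-, R, -, Q, hQ, rfl⟩ := hP
    exact ⟨Q, hQ, hyP.2⟩

theorem sUnion_fanAt_subset_span (K : PolyhedralComplex E) (F : Set E) :
    ⋃₀ K.fanAt F ⊆ Submodule.span ℝ F := by
  rintro y ⟨_, ⟨P, ⟨-, -, hPF⟩, rfl⟩, t, ht, hy⟩
  have := Submodule.smul_mem _ t⁻¹ (Submodule.subset_span (R := ℝ) (hPF hy))
  rwa [smul_smul, inv_mul_cancel₀ ht.ne', one_smul] at this

/-- Genericity implies that the direction is not constant on any nonzero cone of the slice. -/
theorem IsGeneric.fanAt_subset {K : PolyhedralComplex E} {a a' : E} (h : K.IsGeneric 0 a)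
    (ha : ∀ y ∈ Submodule.span ℝ F, ⟪y, a⟫ = ⟪y, a'⟫) :
    ∀ σ ∈ K.fanAt F, (∀ y ∈ σ, ⟪a', y⟫ = 0) → σ ⊆ {0} := by
  rintro _ ⟨P, ⟨hP, hP0, hPF⟩, rfl⟩ hσ y ⟨t, ht, hy⟩
  have hP : P = {0} := h P hP fun z hz => by
    rw [Set.mem_ofPred_eq, sub_zero, ha z (Submodule.subset_span (hPF hz)), real_inner_comm]
    exact hσ z (subset_coneAt P hz)
  rw [hP] at hy
  exact (smul_eq_zero.1 hy).resolve_left ht.ne'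

end PolyhedralComplex

/-! ### Assembly of the product structure -/

theorem eventually_nhds_zero_iff_exists_norm_le {E : Type*} [NormedAddCommGroup E] {p : E → Prop} :
    (∀ᶠ y in 𝓝 (0 : E), p y) ↔ ∃ r > 0, ∀ y, ‖y‖ ≤ r → p y := by
  rw [Metric.nhds_basis_closedBall.eventually_iff]
  simp only [mem_closedBall_zero_iff, gt_iff_lt]

/-- The zero functional vanishes on every cone of the slice, so genericity with `a' = 0` makes each
of them `{0}`. -/
theorem PolyhedralComplex.zero_isolated [FiniteDimensional ℝ E] {K K' : PolyhedralComplex E}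
    {F : Set E} (hF : F ∈ K.faces) (h0 : (0 : E) ∈ intrinsicInterior ℝ F)
    (h0' : (0 : E) ∈ K'.space) {a : E} (hgen : (K.inter K').IsGeneric 0 a)
    (ha : ∀ y ∈ Submodule.span ℝ F, ⟪y, a⟫ = 0) :
    ∃ ε > 0, K'.space ∩ (Submodule.span ℝ F : Set E) ∩ Metric.ball 0 ε = {0} := by
  obtain ⟨ε, hε, h⟩ := eventually_nhds_zero_iff_exists_norm_le.1
    (eventually_mem_slice_iff (K' := K') hF h0)
  refine ⟨ε, hε, Set.Subset.antisymm ?_ ?_⟩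
  · rintro y ⟨hy, hyε⟩
    obtain ⟨σ, hσ, hyσ⟩ := (h y (mem_ball_zero_iff.1 hyε).le).1 hy
    exact hgen.fanAt_subset (a' := 0) (by simpa using ha) σ hσ (by simp) hyσ
  · rintro _ rfl
    exact ⟨⟨h0', zero_mem _⟩, Metric.mem_ball_self hε⟩

/-- The product structure of the cone / link pair, for a direction that restricts to `a₁` and `a₂`
on the spans of complementary faces. -/
theorem coneLinkProduct_of_isCompl [FiniteDimensional ℝ E] {K₁ K₂ : PolyhedralComplex E}
    {F₁ F₂ : Set E} (hF₁ : F₁ ∈ K₁.faces) (hF₂ : F₂ ∈ K₂.faces)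
    (h₁ : (0 : E) ∈ intrinsicInterior ℝ F₁) (h₂ : (0 : E) ∈ intrinsicInterior ℝ F₂)
    (hc : IsCompl (Submodule.span ℝ F₁) (Submodule.span ℝ F₂)) {a a₁ a₂ : E}
    (ha₁ : ∀ y ∈ Submodule.span ℝ F₁, ⟪y, a⟫ = ⟪y, a₁⟫)
    (ha₂ : ∀ y ∈ Submodule.span ℝ F₂, ⟪y, a⟫ = ⟪y, a₂⟫)
    (hgen : (K₁.inter K₂).IsGeneric 0 a) :
    ConeLinkProduct K₁.space K₂.space (Submodule.span ℝ F₁) (Submodule.span ℝ F₂) a a₁ a₂ := by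
  have hgen' := hgen.inter_comm
  have h0₁ : (0 : E) ∈ F₁ := intrinsicInterior_subset h₁
  have h0₂ : (0 : E) ∈ F₂ := intrinsicInterior_subset h₂
  refine ⟨fun h => ?_, fun h => ?_, ?_⟩
  · exact PolyhedralComplex.zero_isolated hF₁ h₁ ⟨F₂, hF₂, h0₂⟩ hgen (by simpa [h] using ha₁)
  · exact PolyhedralComplex.zero_isolated hF₂ h₂ ⟨F₁, hF₁, h0₁⟩ hgen' (by simpa [h] using ha₂)
  have hinter : F₁ ∩ F₂ = {0} := by
    refine Set.Subset.antisymm (fun y hy => ?_) (by simpa using ⟨h0₁, h0₂⟩)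
    exact Submodule.disjoint_def.1 hc.disjoint y (Submodule.subset_span hy.1)
      (Submodule.subset_span hy.2)
  -- That `{0}` is itself a face is what makes the tangent cones pointed.
  have hv : {0} ∈ (K₁.inter K₂).faces :=
    ⟨Set.singleton_nonempty 0, F₁, hF₁, F₂, hF₂, hinter.symm⟩
  have hv' : {0} ∈ (K₂.inter K₁).faces :=
    ⟨Set.singleton_nonempty 0, F₂, hF₂, F₁, hF₁, by rw [Set.inter_comm, hinter]⟩
  have fan₁ := (K₁.inter K₂).pointedFan_fanAt F₁ hv
  have fan₂ := (K₂.inter K₁).pointedFan_fanAt F₂ hv'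
  obtain ⟨p₁, q₁, hs₁, -⟩ := fan₁.splits (f := innerSL ℝ a₁) (hgen.fanAt_subset ha₁)
  obtain ⟨p₂, q₂, hs₂, -⟩ := fan₂.splits (f := innerSL ℝ a₂) (hgen'.fanAt_subset ha₂)
  set A₁ := ⋃₀ (K₁.inter K₂).fanAt F₁
  set A₂ := ⋃₀ (K₂.inter K₁).fanAt F₂
  have hA₁ : A₁ ⊆ Submodule.span ℝ F₁ := PolyhedralComplex.sUnion_fanAt_subset_span _ _
  have hA₂ : A₂ ⊆ Submodule.span ℝ F₂ := PolyhedralComplex.sUnion_fanAt_subset_span _ _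
  have loc₁ := PolyhedralComplex.eventually_mem_slice_iff (K' := K₂) hF₁ h₁
  have loc₂ := PolyhedralComplex.eventually_mem_slice_iff (K' := K₁) hF₂ h₂
  let π₁ : E →L[ℝ] E :=
    LinearMap.toContinuousLinearMap (Submodule.projection _ _ hc)
  let π₂ : E →L[ℝ] E :=
    LinearMap.toContinuousLinearMap (Submodule.projection _ _ hc.symm)
  have hπ₁ : ∀ y, π₁ y ∈ Submodule.span ℝ F₁ := Submodule.projection_apply_mem hc
  have hπ₂ : ∀ y, π₂ y ∈ Submodule.span ℝ F₂ := Submodule.projection_apply_mem hc.symm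
  have hπ₁l : ∀ y ∈ Submodule.span ℝ F₁, π₁ y = y := fun y hy =>
    Submodule.projection_apply_of_mem_left hc hy
  have hπ₂l : ∀ y ∈ Submodule.span ℝ F₂, π₂ y = y := fun y hy =>
    Submodule.projection_apply_of_mem_left hc.symm hy
  have hπ₁r : ∀ y ∈ Submodule.span ℝ F₂, π₁ y = 0 := fun y hy =>
    Submodule.projection_apply_of_mem_right hc hy
  have hπ₂r : ∀ y ∈ Submodule.span ℝ F₁, π₂ y = 0 := fun y hy =>
    Submodule.projection_apply_of_mem_right hc.symm hy
  have hadd : ∀ y, π₁ y + π₂ y = y := fun y => by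
    obtain ⟨u, hu, v, hv, rfl⟩ := Submodule.mem_sup.1
      (show y ∈ Submodule.span ℝ F₁ ⊔ Submodule.span ℝ F₂ by rw [hc.sup_eq_top]; trivial)
    rw [map_add, map_add, hπ₁l u hu, hπ₁r v hv, hπ₂r u hu, hπ₂l v hv]
    abel
  have inv₁ := PolyhedralComplex.eventually_mem_space_iff hF₁ h₁ π₂.continuous (map_zero π₂)
    (fun y => by
      have : y - π₂ y = π₁ y := sub_eq_of_eq_add (hadd y).symm
      rw [this]; exact hπ₁ y)
  have inv₂ := PolyhedralComplex.eventually_mem_space_iff hF₂ h₂ π₁.continuous (map_zero π₁)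
    (fun y => by
      have : y - π₁ y = π₂ y := sub_eq_of_eq_add' (hadd y).symm
      rw [this]; exact hπ₂ y)
  have ht₁ : Tendsto π₁ (𝓝 0) (𝓝 0) := by simpa using π₁.continuous.tendsto 0
  have ht₂ : Tendsto π₂ (𝓝 0) (𝓝 0) := by simpa using π₂.continuous.tendsto 0
  let j : E × E →L[ℝ] E := ContinuousLinearMap.fst ℝ E E + ContinuousLinearMap.snd ℝ E E
  have hj : ∀ v, j v = v.1 + v.2 := fun v => rfl
  -- By translation invariance, membership in `K₁.space` depends only on `π₂ y` and membership in
  -- `K₂.space` only on `π₁ y`.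
  have loc : ∀ᶠ y in 𝓝 (0 : E), y ∈ K₁.space ∩ K₂.space ↔ ∃ v ∈ A₁ ×ˢ A₂, j v = y := by
    filter_upwards [inv₁, inv₂, ht₁.eventually loc₁, ht₂.eventually loc₂] with y i₁ i₂ l₁ l₂
    rw [Set.mem_inter_iff, i₁, i₂]
    constructor
    · rintro ⟨hy₂, hy₁⟩
      exact ⟨(π₁ y, π₂ y), ⟨l₁.1 ⟨hy₁, hπ₁ y⟩, l₂.1 ⟨hy₂, hπ₂ y⟩⟩, hadd y⟩
    · rintro ⟨⟨u, v⟩, ⟨hu, hv⟩, rfl⟩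
      have e₁ : π₁ (j (u, v)) = u := by
        rw [hj, map_add, hπ₁l u (hA₁ hu), hπ₁r v (hA₂ hv), add_zero]
      have e₂ : π₂ (j (u, v)) = v := by
        rw [hj, map_add, hπ₂r u (hA₁ hu), hπ₂l v (hA₂ hv), zero_add]
      exact ⟨(l₂.2 (by rw [e₂]; exact hv)).1, (l₁.2 (by rw [e₁]; exact hu)).1⟩
  -- Normalising multiplies the height by a positive number, or leaves it zero when `b = 0`.
  have sign : ∀ (b : E) (A : Set E) (p q : E → E), SignSplitting A (innerSL ℝ b) p q →
      SignSplitting A (innerSL ℝ (‖b‖⁻¹ • b)) p q := by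
    intro b A p q h
    have e : ∀ y, innerSL ℝ (‖b‖⁻¹ • b) y = ‖b‖⁻¹ * innerSL ℝ b y := fun y => by
      simp
    rcases eq_or_ne b 0 with rfl | hb
    · simpa using h
    have hb' : 0 < ‖b‖⁻¹ := inv_pos.2 (norm_pos_iff.2 hb)
    exact h.of_sign (fun y _ hy => by rw [e]; exact mul_pos hb' hy)
      (fun y _ hy => by rw [e]; exact mul_neg_of_pos_of_neg hb' hy)
  have slice : ∀ (b : E) (A : Set E) (p q : E → E), IsClosed A →
      SignSplitting A (innerSL ℝ b) p q → ∃ κ > 0, ∀ (X : Set E) (r δ : ℝ), 0 < r → 0 < δ →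
      δ ≤ κ * r → (∀ y, ‖y‖ ≤ r → (y ∈ X ↔ y ∈ A)) →
      (coneLink X 0 (‖b‖⁻¹ • b) r δ).IsHomeomorphic (splitPair A p q) := by
    intro b A p q hA h
    obtain ⟨κ, hκ, hh⟩ := (sign b A p q h).exists_coneLink_isHomeomorphic hA
      (ContinuousLinearMap.id ℝ E) (‖b‖⁻¹ • b) (fun v _ => real_inner_comm _ _) one_pos
      (fun x _ y _ => by simp)
    exact ⟨κ, hκ, fun X r δ hr hδ hδr hX => hh X r δ hr hδ hδr fun y hy => by simp [hX y hy]⟩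
  obtain ⟨κ₁, hκ₁, hom₁⟩ := slice a₁ A₁ p₁ q₁ fan₁.isClosed_sUnion hs₁
  obtain ⟨κ₂, hκ₂, hom₂⟩ := slice a₂ A₂ p₂ q₂ fan₂.isClosed_sUnion hs₂
  -- The components of a sum are recovered by the bounded projections, so addition on `A₁ ×ˢ A₂` is
  -- bounded below by the inverse of this constant.
  have hC : 0 < ‖π₁‖ + ‖π₂‖ + 1 := by positivity
  obtain ⟨κ₃, hκ₃, hom₃⟩ := (hs₁.prod hs₂).exists_coneLink_isHomeomorphic
    (fan₁.isClosed_sUnion.prod fan₂.isClosed_sUnion) j a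
    (by
      rintro ⟨u, v⟩ ⟨hu, hv⟩
      rw [hj, inner_add_left, ha₁ u (hA₁ hu), ha₂ v (hA₂ hv)]
      simp [real_inner_comm])
    (inv_pos.2 hC)
    (by
      rintro ⟨u, v⟩ ⟨hu, hv⟩ ⟨u', v'⟩ ⟨hu', hv'⟩
      have hu0 := sub_mem (hA₁ hu) (hA₁ hu')
      have hv0 := sub_mem (hA₂ hv) (hA₂ hv')
      rw [inv_mul_le_iff₀ hC, ← map_sub, Prod.mk_sub_mk, Prod.norm_mk, hj]
      set w := (u - u') + (v - v') with hw
      have e₁ : u - u' = π₁ w := by rw [hw, map_add, hπ₁l _ hu0, hπ₁r _ hv0, add_zero]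
      have e₂ : v - v' = π₂ w := by rw [hw, map_add, hπ₂r _ hu0, hπ₂l _ hv0, zero_add]
      rw [e₁, e₂]
      have n₁ := π₁.le_opNorm w
      have n₂ := π₂.le_opNorm w
      have g₁ : 0 ≤ ‖π₁‖ * ‖w‖ := by positivity
      have g₂ : 0 ≤ ‖π₂‖ * ‖w‖ := by positivity
      have := norm_nonneg w
      rw [max_le_iff]
      constructor <;> linarith)
  obtain ⟨ρ, hρ, hloc⟩ := eventually_nhds_zero_iff_exists_norm_le.1 (loc.and (loc₁.and loc₂))
  refine ⟨ρ, hρ, min κ₃ (min κ₁ κ₂), by positivity, ?_⟩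
  rintro r δ r₁ δ₁ r₂ δ₂ ⟨hr, hrρ, hδ, hδr⟩ ⟨hr₁, hrρ₁, hδ₁, hδr₁⟩ ⟨hr₂, hrρ₂, hδ₂, hδr₂⟩
  have H₃ := hom₃ (K₁.space ∩ K₂.space) r δ hr hδ
    (hδr.trans (by gcongr; exact min_le_left _ _)) fun y hy => (hloc y (hy.trans hrρ)).1
  have H₁ := hom₁ (K₂.space ∩ Submodule.span ℝ F₁) r₁ δ₁ hr₁ hδ₁
    (hδr₁.trans (by gcongr; exact (min_le_right _ _).trans (min_le_left _ _)))
    fun y hy => (hloc y (hy.trans hrρ₁)).2.1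
  have H₂ := hom₂ (K₁.space ∩ Submodule.span ℝ F₂) r₂ δ₂ hr₂ hδ₂
    (hδr₂.trans (by gcongr; exact (min_le_right _ _).trans (min_le_right _ _)))
    fun y hy => (hloc y (hy.trans hrρ₂)).2.2
  rw [splitPair_prod] at H₃
  exact H₃.trans (H₁.prod H₂).symm

/-- A common vector of the spans, scaled down, lies in both relative interiors. -/
theorem disjoint_span_of_intrinsicInterior_inter {F₁ F₂ : Set E}
    (h0 : intrinsicInterior ℝ F₁ ∩ intrinsicInterior ℝ F₂ = {0}) :
    Disjoint (Submodule.span ℝ F₁) (Submodule.span ℝ F₂) := by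
  have h : (0 : E) ∈ intrinsicInterior ℝ F₁ ∩ intrinsicInterior ℝ F₂ := by rw [h0]; rfl
  rw [Submodule.disjoint_def]
  intro y hy₁ hy₂
  obtain ⟨s, ⟨hs₁, hs₂⟩, hs⟩ := (((tendsto_smul_zero y).eventually
    ((eventually_mem_intrinsicInterior h.1).and (eventually_mem_intrinsicInterior h.2))).and
    self_mem_nhdsWithin).exists
  have : s • y ∈ ({0} : Set E) := by
    rw [← h0]
    exact ⟨hs₁ (Submodule.smul_mem _ _ hy₁), hs₂ (Submodule.smul_mem _ _ hy₂)⟩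
  exact (smul_eq_zero.1 this).resolve_left (ne_of_gt hs)

end LocalStructure

theorem proposition2p5 (n k : ℕ) (hk : k ≤ n)
    (K₁ K₂ : PolyhedralComplex (EuclideanSpace ℝ (Fin n)))
    (F₁ F₂ : Set (EuclideanSpace ℝ (Fin n))) (hF₁ : F₁ ∈ K₁.faces) (hF₂ : F₂ ∈ K₂.faces)
    (h0 : intrinsicInterior ℝ F₁ ∩ intrinsicInterior ℝ F₂ = {0})
    (E₁ E₂ : Submodule ℝ (EuclideanSpace ℝ (Fin n)))
    (hE₁ : E₁ = Submodule.span ℝ F₁) (hE₂ : E₂ = Submodule.span ℝ F₂)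
    (hdim₁ : Module.finrank ℝ E₁ = k) (hdim₂ : Module.finrank ℝ E₂ = n - k)
    (a : EuclideanSpace ℝ (Fin n)) (ha : ‖a‖ = 1)
    (hgen : (K₁.inter K₂).IsGeneric 0 a) :
    -- the orthogonal case
    (E₁ ⟂ E₂ → ∀ a₁ ∈ E₁, ∀ a₂ ∈ E₂, a = a₁ + a₂ →
      ConeLinkProduct K₁.space K₂.space E₁ E₂ a a₁ a₂) ∧
    -- the general case of complementary `E₁`, `E₂`
    ConeLinkProduct K₁.space K₂.space E₁ E₂ a (E₁.starProjection a) (E₂.starProjection a) := by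
  have h : (0 : EuclideanSpace ℝ (Fin n)) ∈ intrinsicInterior ℝ F₁ ∩ intrinsicInterior ℝ F₂ := by
    rw [h0]; rfl
  have hc : IsCompl E₁ E₂ := by
    have hd : Disjoint E₁ E₂ := by
      rw [hE₁, hE₂]
      exact disjoint_span_of_intrinsicInterior_inter h0
    refine (Submodule.isCompl_iff_disjoint E₁ E₂ ?_).2 hd
    rw [hdim₁, hdim₂, finrank_euclideanSpace_fin]
    omega
  -- Both cases only need that `a` and `aᵢ` define the same functional on `Eᵢ`; in the oblique case
  -- `a` need not equal `a₁ + a₂`.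
  have main : ∀ a₁ a₂ : EuclideanSpace ℝ (Fin n), (∀ y ∈ E₁, ⟪y, a⟫ = ⟪y, a₁⟫) →
      (∀ y ∈ E₂, ⟪y, a⟫ = ⟪y, a₂⟫) → ConeLinkProduct K₁.space K₂.space E₁ E₂ a a₁ a₂ := by
    subst hE₁ hE₂
    exact fun a₁ a₂ ha₁ ha₂ => coneLinkProduct_of_isCompl hF₁ hF₂ h.1 h.2 hc ha₁ ha₂ hgen
  refine ⟨fun hperp a₁ ha₁ a₂ ha₂ hsum => main a₁ a₂ (fun y hy => ?_) (fun y hy => ?_),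
    main _ _ (fun y hy => ?_) (fun y hy => ?_)⟩
  · rw [hsum, inner_add_right, Submodule.isOrtho_iff_inner_eq.1 hperp y hy a₂ ha₂, add_zero]
  · rw [hsum, inner_add_right, Submodule.isOrtho_iff_inner_eq.1 hperp.symm y hy a₁ ha₁, zero_add]
  · have := E₁.starProjection_inner_eq_zero a y hy
    rw [real_inner_comm, inner_sub_right] at this
    linarith
  · have := E₂.starProjection_inner_eq_zero a y hy
    rw [real_inner_comm, inner_sub_right] at this
    linarith
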